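/- Let $1\le k\le d$ be integers. For $E\subset\mathbb{R}^d$, let $T_k(E)=E^{k+1}/\!\sim$, where $(x^1,\dots,x^{k+1})\sim(y^1,\dots,y^{k+1})$ if and only if there are $g\in O(d)$ and $z\in\mathbb{R}^d$ with $y^j=gx^j+z$ for all $1\le j\le k+1$. Congruence classes are viewed as points of $\mathbb{R}^{\binom{k+1}{2}}$ through the well-defined map $[(x^1,\dots,x^{k+1})]\mapsto(|x^i-x^j|)_{1\le i<j\le k+1}$. For $x\in E$, the set of $k$-simplices of $E$ pinned at $x$ is the set of those classes in $T_k(E)$ that have a representative $(x^1,\dots,x^{k+1})\in E^{k+1}$ with $x^1=x$. If $E\subset\mathbb{R}^d$ is compact and its Hausdorff dimension satisfies $$\dim_H(E)>\frac{d+k}{2},$$ then there exists $x\in E$ such that the set of $k$-simplices of $E$ pinned at $x$ has positive Lebesgue measure, that is, $$\mathcal{L}^{\binom{k+1}{2}}\Big(\Big\{\big(|x^i-x^j|\big)_{1\le i<j\le k+1}\ :\ x^1=x,\ x^2,\dots,x^{k+1}\in E\Big\}\Big)>0.$$ -/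

import Mathlib

open MeasureTheory
open scoped ENNReal

namespace PinnedSimplex

/-- Two `(k+1)`-tuples of points of `ℝ^d` are congruent when some orthogonal map followed by a
translation carries the first, vertex by vertex, onto the second. -/
def IsCongruent {d k : ℕ} (v w : Fin (k + 1) → EuclideanSpace ℝ (Fin d)) : Prop :=
  ∃ (g : EuclideanSpace ℝ (Fin d) ≃ₗᵢ[ℝ] EuclideanSpace ℝ (Fin d))
    (z : EuclideanSpace ℝ (Fin d)), ∀ j, w j = g (v j) + z

theorem isCongruent_equivalence (d k : ℕ) :
    Equivalence (IsCongruent (d := d) (k := k)) where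
  refl v := ⟨LinearIsometryEquiv.refl ℝ _, 0, fun j => by simp⟩
  symm := by
    rintro v w ⟨g, z, h⟩
    exact ⟨g.symm, -g.symm z, fun j => by simp [h j]⟩
  trans := by
    rintro u v w ⟨g, z, h⟩ ⟨g', z', h'⟩
    exact ⟨g.trans g', g' z + z', fun j => by simp [h j, h' j, add_assoc]⟩

/-- The congruence relation on `(k+1)`-tuples of points of `ℝ^d`. -/
def congruenceSetoid (d k : ℕ) : Setoid (Fin (k + 1) → EuclideanSpace ℝ (Fin d)) :=
  ⟨IsCongruent, isCongruent_equivalence d k⟩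

/-- Congruence classes of (possibly degenerate) `k`-simplices in `ℝ^d`. -/
abbrev CongruenceClass (d k : ℕ) : Type := Quotient (congruenceSetoid d k)

/-- `T_k(E) = E^{k+1}/∼`: the congruence classes of `k`-simplices with all vertices in `E`. -/
def simplices {d : ℕ} (k : ℕ) (E : Set (EuclideanSpace ℝ (Fin d))) :
    Set (CongruenceClass d k) :=
  {σ | ∃ v : Fin (k + 1) → EuclideanSpace ℝ (Fin d),
    (∀ j, v j ∈ E) ∧ Quotient.mk (congruenceSetoid d k) v = σ}

/-- The congruence classes of `k`-simplices with all vertices in `E` and first vertex `x`. -/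
def pinnedSimplices {d : ℕ} (k : ℕ) (E : Set (EuclideanSpace ℝ (Fin d)))
    (x : EuclideanSpace ℝ (Fin d)) : Set (CongruenceClass d k) :=
  {σ | ∃ v : Fin (k + 1) → EuclideanSpace ℝ (Fin d),
    (∀ j, v j ∈ E) ∧ v 0 = x ∧ Quotient.mk (congruenceSetoid d k) v = σ}

theorem pinnedSimplices_subset {d : ℕ} (k : ℕ) (E : Set (EuclideanSpace ℝ (Fin d)))
    (x : EuclideanSpace ℝ (Fin d)) : pinnedSimplices k E x ⊆ simplices k E := by
  rintro σ ⟨v, hv, -, h⟩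
  exact ⟨v, hv, h⟩

/-- The index set of the pairs `i < j` of vertices of a `k`-simplex. -/
abbrev VertexPair (k : ℕ) : Type := {p : Fin (k + 1) × Fin (k + 1) // p.1 < p.2}

/-- There are `binom (k+1) 2` pairs, so `VertexPair k → ℝ` is `ℝ^{binom (k+1) 2}`. -/
theorem card_vertexPair (k : ℕ) : Fintype.card (VertexPair k) = (k + 1).choose 2 := by
  have hc := Sym2.card_subtype_not_diag (α := Fin (k + 1))
  rw [Fintype.card_fin] at hc
  rw [← hc]
  refine Fintype.card_congr (Equiv.ofBijective
    (fun p => ⟨s(p.1.1, p.1.2), by simpa using p.2.ne⟩) ⟨?_, ?_⟩)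
  · rintro ⟨⟨a, b⟩, h⟩ ⟨⟨c, e⟩, h'⟩ hh
    simp at hh h h' ⊢
    grind
  · rintro ⟨s, hs⟩
    induction s with | _ a b =>
    simp at hs
    rcases lt_or_gt_of_ne hs with h | h
    · exact ⟨⟨(a, b), h⟩, rfl⟩
    · exact ⟨⟨(b, a), h⟩, by simp [Sym2.eq_swap]⟩

/-- The map `[(x^1, …, x^{k+1})] ↦ (|x^i - x^j|)_{i<j}` on congruence classes. -/
noncomputable def sideLengths {d k : ℕ} : CongruenceClass d k → (VertexPair k → ℝ) :=
  Quotient.lift (fun v p => ‖v p.1.1 - v p.1.2‖) (by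
    rintro v w ⟨g, z, h⟩
    funext p
    simp [h, ← map_sub])

end PinnedSimplex

/-! ### Gaussian regularisation and square-integrable characteristic functions -/

section Fourier

open Filter Topology Module
open scoped RealInnerProductSpace Real

/-! Choose `(d+k)/2 < s < dimH E` and a Frostman probability measure `μ` on `E` of exponent `s`
(`exists_frostman_measure`). It is enough that, for `μ`-a.e. `x`, the side lengths of `(x, w_1, …,
w_k)` with `w` distributed as `μ^k` have an absolutely continuous law. A simplex is built one vertex
at a time, and Fubini reduces this claim to the distances from one new vertex `y` to `m + 1 ≤ k`
pins: for a.e. choice of pins their joint law must be absolutely continuous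
(`ae_absolutelyContinuous_map_norm_sub`).

The identity `|x - y|² - |x|² = ⟪(1, -2x), (|y|², y)⟫` makes squared distances linear in the lift of
`y` to the paraboloid in `ℝ^(d+1)`. If `σ` is the lifted measure, the characteristic function of the
law at `τ` is therefore `σ̂(∑ τ_i (1, -2x_i))`. A finite measure with square-integrable
characteristic function is absolutely continuous, so the goal is finiteness of `∫∫ |σ̂(∑ τ_i (1,
-2x_i))|² dτ dμ^(m+1)(x)`.

As `σ` has compact support, it is a Gaussian times a finite measure `ρ`, and `|σ̂|²` is dominated by
`|ρ̂|²` convolved with a Gaussian. By Tonelli the integral is at most `∫ |ρ̂(ζ)|² κ(ζ) dζ`, where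
`κ(ζ)` averages a Gaussian centred at `ζ` over all combinations. Integrating over the pin with the
largest coefficient gains `(1 + ‖τ‖)^(-s)`, and the head coordinate `∑ τ_i` confines `τ` to a slab,
of effective dimension `m`. Hence `κ(ζ) ≲ (1 + |ζ|²)^(-q/2)` when `q < s - m`, while the energy of
`ρ` controls `∫ |ρ̂|² (1 + |ζ|²)^(-q/2)` when `q > d + 1 - s`. Such a `q` exists exactly when `s >
(d + m + 1)/2`; the worst case `m + 1 = k` gives the threshold. -/

theorem measure_closedBall_le_mul_lintegral_gaussian {V : Type*} [NormedAddCommGroup V]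
    [MeasurableSpace V] [BorelSpace V] {r : ℝ} (hr : 0 < r) (ρ : Measure V) (x : V) :
    ρ (Metric.closedBall x r) ≤ ENNReal.ofReal (Real.exp 1) *
      ∫⁻ z, ENNReal.ofReal (Real.exp (-‖x - z‖ ^ 2 / r ^ 2)) ∂ρ := by
  rw [← lintegral_const_mul' _ _ ENNReal.ofReal_ne_top, ← lintegral_indicator_one
    Metric.isClosed_closedBall.measurableSet]
  refine lintegral_mono (Set.indicator_le (fun z hz => ?_))
  rw [← ENNReal.ofReal_mul (Real.exp_pos _).le, ← Real.exp_add, Pi.one_apply,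
    ENNReal.one_le_ofReal, Real.one_le_exp_iff]
  rw [mem_closedBall_iff_norm'] at hz
  have : ‖x - z‖ ^ 2 / r ^ 2 ≤ 1 := by
    rw [div_le_one (by positivity)]
    gcongr
  rw [neg_div]
  linarith

variable {V : Type*} [NormedAddCommGroup V] [InnerProductSpace ℝ V] [FiniteDimensional ℝ V]
  [MeasurableSpace V] [BorelSpace V]

theorem integral_gaussian_mul_char {t : ℝ} (ht : 0 < t) (w : V) :
    ∫ v : V, (Real.exp (-t * ‖v‖ ^ 2) : ℂ) * Complex.exp (⟪w, v⟫ * Complex.I) =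
      ((π / t) ^ (finrank ℝ V / 2 : ℝ) * Real.exp (-‖w‖ ^ 2 / (4 * t)) : ℝ) := by
  have h := GaussianFourier.integral_cexp_neg_mul_sq_norm_add (V := V) (b := (t : ℂ))
    (by simpa using ht) Complex.I w
  rw [Complex.ofReal_mul, Complex.ofReal_cpow (by positivity)]
  push_cast
  rw [show -(‖w‖ : ℂ) ^ 2 / (4 * t) = Complex.I ^ 2 * (‖w‖ : ℂ) ^ 2 / (4 * t) by
    rw [Complex.I_sq]; ring, ← h]
  refine integral_congr_ae (Eventually.of_forall fun v => ?_)
  simp only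
  rw [← Complex.exp_add]
  ring_nf

theorem integrable_gaussian_norm {t : ℝ} (ht : 0 < t) :
    Integrable (fun v : V => Real.exp (-t * ‖v‖ ^ 2)) := by
  have h := (GaussianFourier.integrable_cexp_neg_mul_sq_norm_add (V := V) (b := (t : ℂ))
    (by simpa using ht) 0 0).norm
  refine h.congr (Eventually.of_forall fun v => ?_)
  have : ((-t : ℂ) * (‖v‖ : ℂ) ^ 2) = ((-t * ‖v‖ ^ 2 : ℝ) : ℂ) := by push_cast; ring
  simp only [zero_mul, add_zero, this, Complex.norm_exp, Complex.ofReal_re]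

theorem integrable_gaussian_mul_char_prod {t : ℝ} (ht : 0 < t) (ρ : Measure V)
    [IsFiniteMeasure ρ] :
    Integrable (fun p : V × V => (Real.exp (-t * ‖p.1‖ ^ 2) : ℂ) *
      Complex.exp (⟪p.2, p.1⟫ * Complex.I)) ((volume : Measure V).prod ρ) := by
  have h : Integrable (fun p : V × V => Real.exp (-t * ‖p.1‖ ^ 2) * (1 : ℝ))
      ((volume : Measure V).prod ρ) :=
    (integrable_gaussian_norm ht).mul_prod (integrable_const (1 : ℝ))
  refine h.mono' (by fun_prop) (Eventually.of_forall fun p => ?_)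
  rw [norm_mul, Complex.norm_exp_ofReal_mul_I, Complex.norm_real,
    Real.norm_of_nonneg (Real.exp_pos _).le]

theorem integral_gaussian_mul_charFun {t : ℝ} (ht : 0 < t) (ρ : Measure V) [IsFiniteMeasure ρ] :
    ∫ ζ : V, (Real.exp (-t * ‖ζ‖ ^ 2) : ℂ) * charFun ρ ζ =
      (((π / t) ^ (finrank ℝ V / 2 : ℝ) * ∫ w, Real.exp (-‖w‖ ^ 2 / (4 * t)) ∂ρ : ℝ) : ℂ) := by
  simp_rw [charFun_apply, ← integral_const_mul]
  rw [integral_integral_swap (integrable_gaussian_mul_char_prod ht ρ)]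
  simp_rw [integral_gaussian_mul_char ht]
  rw [integral_complex_ofReal]

/-- Reflecting a measure conjugates its transform. This turns `|ρ̂|²` into a single characteristic
function, to which Gaussian duality applies. -/
theorem charFun_map_sub_prod (ρ : Measure V) [IsFiniteMeasure ρ] (ζ : V) :
    charFun ((ρ.prod ρ).map (fun p => p.1 - p.2)) ζ = ((‖charFun ρ ζ‖ ^ 2 : ℝ) : ℂ) := by
  rw [charFun_apply, integral_map (by fun_prop) (by fun_prop)]
  have : ∀ p : V × V, Complex.exp (⟪p.1 - p.2, ζ⟫ * Complex.I) =
      Complex.exp (⟪p.1, ζ⟫ * Complex.I) * Complex.exp (⟪p.2, -ζ⟫ * Complex.I) := by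
    intro p
    rw [← Complex.exp_add, inner_sub_left, inner_neg_right]
    push_cast
    ring_nf
  simp_rw [this]
  rw [integral_prod_mul (f := fun y => Complex.exp (⟪y, ζ⟫ * Complex.I))
    (g := fun y => Complex.exp (⟪y, -ζ⟫ * Complex.I)), ← charFun_apply, ← charFun_apply,
    charFun_neg, Complex.mul_conj, Complex.normSq_eq_norm_sq]

theorem lintegral_norm_sq_charFun_mul_gaussian {t : ℝ} (ht : 0 < t) (ρ : Measure V)
    [IsFiniteMeasure ρ] :
    ∫⁻ ζ, ENNReal.ofReal (‖charFun ρ ζ‖ ^ 2) * ENNReal.ofReal (Real.exp (-t * ‖ζ‖ ^ 2)) =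
      ENNReal.ofReal ((π / t) ^ (finrank ℝ V / 2 : ℝ)) *
        ∫⁻ y, ∫⁻ z, ENNReal.ofReal (Real.exp (-‖y - z‖ ^ 2 / (4 * t))) ∂ρ ∂ρ := by
  have h := integral_gaussian_mul_charFun ht ((ρ.prod ρ).map (fun p => p.1 - p.2))
  simp_rw [charFun_map_sub_prod, ← Complex.ofReal_mul] at h
  rw [integral_complex_ofReal, Complex.ofReal_inj, integral_map (by fun_prop)
    (by fun_prop)] at h
  have hint : Integrable (fun p : V × V => Real.exp (-‖p.1 - p.2‖ ^ 2 / (4 * t)))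
      (ρ.prod ρ) := by
    refine (integrable_const (1 : ℝ)).mono' (by fun_prop) (Eventually.of_forall fun p => ?_)
    rw [Real.norm_of_nonneg (Real.exp_pos _).le, Real.exp_le_one_iff]
    exact div_nonpos_of_nonpos_of_nonneg (by simp) (by positivity)
  have hint' : Integrable (fun ζ : V => Real.exp (-t * ‖ζ‖ ^ 2) * ‖charFun ρ ζ‖ ^ 2) := by
    refine ((integrable_gaussian_norm ht).mul_const ((ρ.real Set.univ) ^ 2)).mono'
      (by
        have := (measurable_charFun (μ := ρ)).norm
        exact (Measurable.mul (by fun_prop) (this.pow_const 2)).aestronglyMeasurable)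
      (Eventually.of_forall fun p => ?_)
    rw [Real.norm_of_nonneg (by positivity)]
    gcongr
    exact norm_charFun_le _
  rw [← lintegral_prod (f := fun p : V × V =>
      ENNReal.ofReal (Real.exp (-‖p.1 - p.2‖ ^ 2 / (4 * t)))) (by fun_prop),
    ← ofReal_integral_eq_lintegral_ofReal hint (Eventually.of_forall fun p => (Real.exp_pos _).le),
    ← ENNReal.ofReal_mul (by positivity), ← h,
    ofReal_integral_eq_lintegral_ofReal hint' (Eventually.of_forall fun p => by positivity)]
  refine lintegral_congr fun ζ => ?_
  rw [← ENNReal.ofReal_mul (by positivity), mul_comm]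

/-- Gaussian duality at `t = r² / 4`, with the frequency cutoff bounded by `1`. The point is that
the bound is uniform in `r`. -/
theorem lintegral_lintegral_gaussian_le {r : ℝ} (hr : 0 < r) (ρ : Measure V) [IsFiniteMeasure ρ] :
    ∫⁻ y, ENNReal.ofReal ((4 * π / r ^ 2) ^ (finrank ℝ V / 2 : ℝ)) *
        ∫⁻ z, ENNReal.ofReal (Real.exp (-‖y - z‖ ^ 2 / r ^ 2)) ∂ρ ∂ρ
      ≤ ∫⁻ ζ, ENNReal.ofReal (‖charFun ρ ζ‖ ^ 2) := by
  rw [lintegral_const_mul' _ _ ENNReal.ofReal_ne_top]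
  have h := lintegral_norm_sq_charFun_mul_gaussian (t := r ^ 2 / 4) (by positivity) ρ
  rw [show π / (r ^ 2 / 4) = 4 * π / r ^ 2 by field_simp,
    show 4 * (r ^ 2 / 4) = r ^ 2 by ring] at h
  rw [← h]
  refine lintegral_mono fun ζ => mul_le_of_le_one_right' ?_
  rw [ENNReal.ofReal_le_one, Real.exp_le_one_iff, neg_mul]
  exact neg_nonpos.2 (by positivity)

/-- A finite measure whose characteristic function is square integrable is absolutely
continuous. -/
theorem absolutelyContinuous_of_lintegral_charFun_sq (ρ : Measure V) [IsFiniteMeasure ρ]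
    (h : ∫⁻ ζ, ENNReal.ofReal (‖charFun ρ ζ‖ ^ 2) ≠ ∞) : ρ ≪ volume := by
  set n := finrank ℝ V with hn
  set r : ℕ → ℝ := fun i => 1 / ((i : ℝ) + 1) with hr
  have hr0 : ∀ i, 0 < r i := fun i => by positivity
  set f : ℕ → V → ℝ≥0∞ := fun i y => ENNReal.ofReal ((4 * π / r i ^ 2) ^ (n / 2 : ℝ)) *
        ∫⁻ z, ENNReal.ofReal (Real.exp (-‖y - z‖ ^ 2 / r i ^ 2)) ∂ρ with hf
  have hfm : ∀ i, Measurable (f i) := fun i => by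
    refine Measurable.const_mul (Measurable.lintegral_prod_right'
      (f := fun p : V × V => ENNReal.ofReal (Real.exp (-‖p.1 - p.2‖ ^ 2 / r i ^ 2))) ?_) _
    fun_prop
  -- Fatou: the lower limit of the Gaussian averages of `ρ` at scales `r i → 0` is `ρ`-a.e. finite.
  have hfatou : ∫⁻ y, liminf (fun i => f i y) atTop ∂ρ ≠ ∞ := by
    refine ne_top_of_le_ne_top h ((lintegral_liminf_le hfm).trans ?_)
    refine liminf_le_of_le (by isBoundedDefault) fun b hb => ?_
    obtain ⟨i, hi⟩ := hb.exists
    exact hi.trans (lintegral_lintegral_gaussian_le (hr0 i) ρ)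
  have hlim : ∀ᵐ y ∂ρ, liminf (fun i => f i y) atTop < ∞ :=
    ae_lt_top (Measurable.liminf hfm) hfatou
  have hr_tend : Tendsto r atTop (𝓝[>] 0) :=
    tendsto_nhdsWithin_iff.2 ⟨tendsto_one_div_add_atTop_nhds_zero_nat,
      Eventually.of_forall hr0⟩
  -- Differentiate volume with respect to `ρ`, not conversely. A zero derivative means `ρ(B)/vol(B)
  -- → ∞` on small balls, hence unbounded Gaussian averages. `K` is the constant in `K ρ(B) ≤ vol(B)
  -- · f i y`.
  have hpos : ∀ᵐ y ∂ρ, (volume : Measure V).rnDeriv ρ y ≠ 0 := by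
    filter_upwards [hlim, Besicovitch.ae_tendsto_rnDeriv (volume : Measure V) ρ] with y hy hB h0
    rw [h0] at hB
    have hB' := hB.comp hr_tend
    obtain ⟨M, hM, hM'⟩ := exists_between hy
    set K : ℝ≥0∞ := ENNReal.ofReal ((4 * π) ^ (n / 2 : ℝ)) * (volume : Measure V)
      (Metric.closedBall 0 1) / ENNReal.ofReal (Real.exp 1) with hK
    have hv : (volume : Measure V) (Metric.closedBall 0 1) ≠ 0 :=
      (Metric.measure_closedBall_pos _ _ one_pos).ne'
    have hK0 : K ≠ 0 := by
      rw [hK, ENNReal.div_ne_zero]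
      refine ⟨mul_ne_zero ?_ hv, ENNReal.ofReal_ne_top⟩
      exact (ENNReal.ofReal_pos.2 (by positivity)).ne'
    have hKM : 0 < K / M := ENNReal.div_pos hK0 hM'.ne_top
    have hev := hB'.eventually (gt_mem_nhds hKM)
    have hfr : ∃ᶠ i in atTop, f i y < M := frequently_lt_of_liminf_lt (by isBoundedDefault) hM
    obtain ⟨i, hi, hi'⟩ := (hfr.and_eventually hev).exists
    refine hi'.not_ge ?_
    simp only [Function.comp]
    have key : K * ρ (Metric.closedBall y (r i)) ≤
        (volume : Measure V) (Metric.closedBall y (r i)) * M := by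
      have hvol := Measure.addHaar_closedBall (volume : Measure V) y (hr0 i).le
      have hvol1 : (volume : Measure V) (Metric.closedBall 0 1) =
        (volume : Measure V) (Metric.ball 0 1) := by
          simpa using Measure.addHaar_closedBall (volume : Measure V) 0 zero_le_one
      have he : ENNReal.ofReal (Real.exp 1) ≠ 0 := (ENNReal.ofReal_pos.2 (Real.exp_pos _)).ne'
      calc K * ρ (Metric.closedBall y (r i))
          ≤ K * (ENNReal.ofReal (Real.exp 1) *
            ∫⁻ z, ENNReal.ofReal (Real.exp (-‖y - z‖ ^ 2 / r i ^ 2)) ∂ρ) := by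
              gcongr
              exact measure_closedBall_le_mul_lintegral_gaussian (hr0 i) ρ y
        _ = (volume : Measure V) (Metric.closedBall 0 1) * (ENNReal.ofReal ((4 * π) ^ (n / 2 : ℝ)) *
            ∫⁻ z, ENNReal.ofReal (Real.exp (-‖y - z‖ ^ 2 / r i ^ 2)) ∂ρ) := by
              rw [hK, ← mul_assoc, ENNReal.div_mul_cancel he ENNReal.ofReal_ne_top]
              ring
        _ = (volume : Measure V) (Metric.closedBall y (r i)) * f i y := by
              have h1 : ENNReal.ofReal ((4 * π) ^ (n / 2 : ℝ)) =
                  ENNReal.ofReal (r i ^ n) * ENNReal.ofReal ((4 * π / r i ^ 2) ^ (n / 2 : ℝ)) := by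
                rw [← ENNReal.ofReal_mul (pow_nonneg (hr0 i).le _),
                  Real.div_rpow (by positivity) (sq_nonneg _),
                  ← Real.rpow_natCast (r i) 2, ← Real.rpow_mul (hr0 i).le,
                  show ((2 : ℕ) : ℝ) * (n / 2 : ℝ) = (n : ℝ) by push_cast; ring, Real.rpow_natCast,
                  mul_div_cancel₀ _ (pow_pos (hr0 i) n).ne']
              rw [hvol, hvol1, h1, ← hn]
              ring
        _ ≤ _ := by gcongr
    rw [ENNReal.le_div_iff_mul_le (Or.inr (Metric.measure_closedBall_pos _ _ (hr0 i)).ne') (Or.inl (measure_ne_top _ _))]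
    rw [← ENNReal.mul_div_right_comm]
    exact ENNReal.div_le_of_le_mul key
  -- The derivative integrates to at most `vol N = 0` over `N` but is nonzero `ρ`-a.e., so `ρ N =
  -- 0`.
  intro N hN
  have h1 : ∫⁻ y in N, (volume : Measure V).rnDeriv ρ y ∂ρ = 0 :=
    le_antisymm ((Measure.setLIntegral_rnDeriv_le N).trans hN.le) zero_le
  rw [lintegral_eq_zero_iff (Measure.measurable_rnDeriv _ _)] at h1
  have h2 := ae_restrict_of_ae (s := N) hpos
  rw [← Measure.restrict_eq_zero, ← ae_eq_bot]
  rw [← Filter.eventually_false_iff_eq_bot]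
  filter_upwards [h1, h2] with y h3 h4 using h4 h3

/-- Cauchy–Schwarz for the Gaussian weight, of total mass `M`, obtained from nonnegativity of the
variance of `‖f‖` about its mean `A / M`. -/
theorem norm_integral_gaussian_sq_le {t : ℝ} (ht : 0 < t) {f : V → ℂ} (hf : Measurable f) {B : ℝ}
    (hB : ∀ v, ‖f v‖ ≤ B) :
    ‖∫ v : V, (Real.exp (-t * ‖v‖ ^ 2) : ℂ) * f v‖ ^ 2 ≤ (π / t) ^ (finrank ℝ V / 2 : ℝ) *
      ∫ v : V, Real.exp (-t * ‖v‖ ^ 2) * ‖f v‖ ^ 2 := by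
  have hG := integrable_gaussian_norm (V := V) ht
  set M : ℝ := (π / t) ^ (finrank ℝ V / 2 : ℝ) with hM
  have hM0 : 0 < M := by positivity
  have hGM : ∫ v : V, Real.exp (-t * ‖v‖ ^ 2) = M :=
    GaussianFourier.integral_rexp_neg_mul_sq_norm ht
  have h1 : Integrable (fun v : V => Real.exp (-t * ‖v‖ ^ 2) * ‖f v‖) := by
    refine hG.mul_bdd (c := B) hf.norm.aestronglyMeasurable (Eventually.of_forall fun v => ?_)
    simpa using hB v
  have h2 : Integrable (fun v : V => Real.exp (-t * ‖v‖ ^ 2) * ‖f v‖ ^ 2) := by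
    refine hG.mul_bdd (c := B ^ 2) (hf.norm.pow_const 2).aestronglyMeasurable
      (Eventually.of_forall fun v => ?_)
    rw [Real.norm_of_nonneg (by positivity)]
    gcongr
    exact hB v
  set A := ∫ v : V, Real.exp (-t * ‖v‖ ^ 2) * ‖f v‖ with hA
  have h3 : ‖∫ v : V, (Real.exp (-t * ‖v‖ ^ 2) : ℂ) * f v‖ ≤ A := by
    refine (norm_integral_le_integral_norm _).trans_eq (integral_congr_ae
      (Eventually.of_forall fun v => ?_))
    simp only [norm_mul, Complex.norm_real, Real.norm_of_nonneg (Real.exp_pos _).le]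
  have h4 : 0 ≤ ∫ v : V, Real.exp (-t * ‖v‖ ^ 2) * (‖f v‖ - A / M) ^ 2 :=
    integral_nonneg fun v => by positivity
  have h5 : ∫ v : V, Real.exp (-t * ‖v‖ ^ 2) * (‖f v‖ - A / M) ^ 2 =
      (∫ v : V, Real.exp (-t * ‖v‖ ^ 2) * ‖f v‖ ^ 2) - 2 * (A / M) * A + (A / M) ^ 2 * M := by
    have e1 : 2 * (A / M) * A = ∫ v : V, 2 * (A / M) * (Real.exp (-t * ‖v‖ ^ 2) * ‖f v‖) := by
      rw [integral_const_mul]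
    have e2 : (A / M) ^ 2 * M = ∫ v : V, (A / M) ^ 2 * Real.exp (-t * ‖v‖ ^ 2) := by
      rw [integral_const_mul, hGM]
    rw [e1, e2, ← integral_sub h2 (h1.const_mul _), ← integral_add (by exact h2.sub (h1.const_mul _))
        (hG.const_mul _)]
    refine integral_congr_ae (Eventually.of_forall fun v => ?_)
    simp only
    ring
  have h6 : A ^ 2 / M ≤ ∫ v : V, Real.exp (-t * ‖v‖ ^ 2) * ‖f v‖ ^ 2 := by
    rw [h5] at h4
    have : (A / M) ^ 2 * M = A ^ 2 / M := by field_simp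
    have h7 : 2 * (A / M) * A = 2 * (A ^ 2 / M) := by ring
    linarith
  rw [div_le_iff₀' hM0] at h6
  calc _ ≤ A ^ 2 := by gcongr
    _ ≤ _ := h6

/-- The Fourier transform of a measure times a Gaussian is locally controlled by the Fourier
transform of the measure. -/
theorem norm_sq_integral_char_mul_gaussian_le (ρ : Measure V) [IsFiniteMeasure ρ] (ξ : V) :
    ENNReal.ofReal (‖∫ y, (Real.exp (-‖y‖ ^ 2 / 2) : ℂ) * Complex.exp (⟪y, ξ⟫ * Complex.I) ∂ρ‖ ^ 2)
      ≤ ∫⁻ ζ, ENNReal.ofReal (‖charFun ρ ζ‖ ^ 2) *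
        ENNReal.ofReal (Real.exp (-(1 / 2) * ‖ζ - ξ‖ ^ 2)) := by
  have ht : (0 : ℝ) < 1 / 2 := by norm_num
  set M : ℝ := (π / (1 / 2)) ^ (finrank ℝ V / 2 : ℝ) with hM
  have hM1 : 1 ≤ M := Real.one_le_rpow (by have := Real.pi_gt_three; linarith) (by positivity)
  have hint : Integrable (fun p : V × V => ((Real.exp (-(1 / 2) * ‖p.1‖ ^ 2) : ℂ) *
      Complex.exp (⟪p.2, p.1⟫ * Complex.I)) * Complex.exp (⟪p.2, ξ⟫ * Complex.I))
      ((volume : Measure V).prod ρ) := by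
    refine (integrable_gaussian_mul_char_prod ht ρ).mul_bdd (c := 1) (by fun_prop)
      (Eventually.of_forall fun p => ?_)
    rw [Complex.norm_exp_ofReal_mul_I]
  -- The Gaussian is its own transform up to the factor `M`, so multiplying `ρ` by it averages the
  -- characteristic function around `ξ`.
  have h1 : ∫ v : V, (Real.exp (-(1 / 2) * ‖v‖ ^ 2) : ℂ) * charFun ρ (v + ξ) =
      (M : ℂ) * ∫ y, (Real.exp (-‖y‖ ^ 2 / 2) : ℂ) * Complex.exp (⟪y, ξ⟫ * Complex.I) ∂ρ := by
    calc _ = ∫ v : V, ∫ y, ((Real.exp (-(1 / 2) * ‖v‖ ^ 2) : ℂ) *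
      Complex.exp (⟪y, v⟫ * Complex.I)) * Complex.exp (⟪y, ξ⟫ * Complex.I) ∂ρ := by
          refine integral_congr_ae (Eventually.of_forall fun v => ?_)
          simp only [charFun_apply]
          rw [← integral_const_mul]
          refine integral_congr_ae (Eventually.of_forall fun y => ?_)
          simp only
          rw [mul_assoc, ← Complex.exp_add, inner_add_right]
          push_cast
          ring_nf
      _ = _ := by
          rw [integral_integral_swap hint, ← integral_const_mul]
          refine integral_congr_ae (Eventually.of_forall fun y => ?_)
          simp only
          rw [integral_mul_const, integral_gaussian_mul_char ht, ← hM,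
            show 4 * (1 / 2 : ℝ) = 2 by norm_num]
          push_cast
          ring_nf
  have h2 := norm_integral_gaussian_sq_le (V := V) ht (f := fun v => charFun ρ (v + ξ))
    (measurable_charFun.comp (measurable_add_const ξ)) (B := ρ.real Set.univ)
    fun v => norm_charFun_le _
  rw [h1, norm_mul, Complex.norm_real, Real.norm_of_nonneg (by positivity), mul_pow] at h2
  set X := ‖∫ y, (Real.exp (-‖y‖ ^ 2 / 2) : ℂ) * Complex.exp (⟪y, ξ⟫ * Complex.I) ∂ρ‖ ^ 2 with hX
  set Y := ∫ v : V, Real.exp (-(1 / 2) * ‖v‖ ^ 2) * ‖charFun ρ (v + ξ)‖ ^ 2 with hY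
  have hX0 : 0 ≤ X := by positivity
  have h3 : X ≤ Y := by
    have : M * (M * X) ≤ M * Y := by rw [← mul_assoc, ← sq]; exact h2
    have := le_of_mul_le_mul_left this (by positivity)
    nlinarith
  refine (ENNReal.ofReal_le_ofReal h3).trans ?_
  rw [hY, ofReal_integral_eq_lintegral_ofReal, ← lintegral_add_right_eq_self (μ := volume)
    (fun ζ => ENNReal.ofReal (‖charFun ρ ζ‖ ^ 2) * _) ξ]
  · refine lintegral_mono fun v => le_of_eq ?_
    rw [add_sub_cancel_right, mul_comm, ENNReal.ofReal_mul (by positivity)]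
  · refine (integrable_gaussian_norm ht).mul_bdd (c := (ρ.real Set.univ) ^ 2)
      ((measurable_charFun.comp (measurable_add_const ξ)).norm.pow_const 2).aestronglyMeasurable
      (Eventually.of_forall fun v => ?_)
    rw [Real.norm_of_nonneg (by positivity)]
    gcongr
    exact norm_charFun_le _
  · exact Eventually.of_forall fun v => by positivity

end Fourier

/-! ### Energy integrals in space and frequency -/

section Energy

open Filter Topology Module Set
open scoped RealInnerProductSpace Real

theorem lintegral_Ioi_exp_neg (u : ℝ) :
    ∫⁻ v in Ioi u, ENNReal.ofReal (Real.exp (-v)) = ENNReal.ofReal (Real.exp (-u)) := by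
  rw [← ofReal_integral_eq_lintegral_ofReal (integrableOn_exp_neg_Ioi u)
    (Eventually.of_forall fun v => (Real.exp_pos _).le), integral_exp_neg_Ioi]

theorem lintegral_Ioi_rpow_mul_exp_neg_mul {a r : ℝ} (ha : 0 < a) (hr : 0 < r) :
    ∫⁻ t in Ioi (0 : ℝ), ENNReal.ofReal (t ^ (a - 1) * Real.exp (-(r * t))) =
      ENNReal.ofReal ((1 / r) ^ a * Real.Gamma a) := by
  -- A non-integrable function would have Bochner integral `0`, but the known value is positive.
  have hint : IntegrableOn (fun t : ℝ => t ^ (a - 1) * Real.exp (-(r * t))) (Ioi 0) := by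
    by_contra h
    have h1 := Real.integral_rpow_mul_exp_neg_mul_Ioi ha hr
    rw [integral_undef h] at h1
    have := Real.Gamma_pos_of_pos ha
    have : 0 < (1 / r) ^ a * Real.Gamma a := by positivity
    linarith
  rw [← Real.integral_rpow_mul_exp_neg_mul_Ioi ha hr, ofReal_integral_eq_lintegral_ofReal hint]
  filter_upwards [ae_restrict_mem measurableSet_Ioi] with t ht
  have : 0 < t := ht
  positivity

/-- If `μ {D ≤ r} ≤ C r ^ s` for all `r > 0` then the Gaussian integral of `D` at scale
`b ^ (-1/2)` is at most a constant times `b ^ (-s/2)`. -/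
theorem lintegral_exp_neg_mul_sq_le {X : Type*} [MeasurableSpace X] (μ : Measure X) [SFinite μ]
    {D : X → ℝ} (hD : Measurable D) {C s : ℝ} (hC : 0 ≤ C) (hs : 0 ≤ s)
    (h : ∀ r : ℝ, 0 < r → μ {y | D y ≤ r} ≤ ENNReal.ofReal (C * r ^ s)) {b : ℝ} (hb : 0 < b) :
    ∫⁻ y, ENNReal.ofReal (Real.exp (-b * D y ^ 2)) ∂μ ≤
      ENNReal.ofReal (C * Real.Gamma (s / 2 + 1) * b ^ (-s / 2)) := by
  -- Layer cake: `exp (-u)` is the integral of `exp (-v)` over `v > u`. After Tonelli the hypothesis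
  -- is used at radius `(v / b)^(1/2)`.
  have h1 : ∀ y, ENNReal.ofReal (Real.exp (-b * D y ^ 2)) = ∫⁻ v in Ioi (0 : ℝ),
      {p : X × ℝ | b * D p.1 ^ 2 < p.2}.indicator
        (fun p => ENNReal.ofReal (Real.exp (-p.2))) (y, v) := by
    intro y
    rw [neg_mul, ← lintegral_Ioi_exp_neg, ← lintegral_indicator measurableSet_Ioi,
      ← lintegral_indicator measurableSet_Ioi]
    refine lintegral_congr fun v => ?_
    have : 0 ≤ b * D y ^ 2 := by positivity
    by_cases hv : b * D y ^ 2 < v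
    · have hv0 : 0 < v := this.trans_lt hv
      simp [hv, hv0]
    · rw [indicator_of_notMem (by simpa using hv)]
      by_cases hv0 : 0 < v <;> simp [hv, hv0]
  have hms : MeasurableSet {p : X × ℝ | b * D p.1 ^ 2 < p.2} :=
    measurableSet_lt (by fun_prop) (by fun_prop)
  simp_rw [h1]
  rw [lintegral_lintegral_swap (f := fun y v => {p : X × ℝ | b * D p.1 ^ 2 < p.2}.indicator
    (fun p => ENNReal.ofReal (Real.exp (-p.2))) (y, v)) (Measurable.aemeasurable
    (Measurable.indicator (f := fun p : X × ℝ => ENNReal.ofReal (Real.exp (-p.2)))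
      (by fun_prop) hms))]
  calc ∫⁻ v in Ioi (0 : ℝ), ∫⁻ y, {p : X × ℝ | b * D p.1 ^ 2 < p.2}.indicator
        (fun p => ENNReal.ofReal (Real.exp (-p.2))) (y, v) ∂μ
      ≤ ∫⁻ v in Ioi (0 : ℝ), ENNReal.ofReal (C * b ^ (-s / 2)) *
        ENNReal.ofReal (v ^ ((s / 2 + 1) - 1) * Real.exp (-(1 * v))) := by
        refine setLIntegral_mono' measurableSet_Ioi fun v hv => ?_
        have hv0 : 0 < v := hv
        have h2 : ∀ y, {p : X × ℝ | b * D p.1 ^ 2 < p.2}.indicator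
            (fun p => ENNReal.ofReal (Real.exp (-p.2))) (y, v) ≤
            {y | D y ≤ (v / b) ^ (1 / 2 : ℝ)}.indicator
              (fun _ => ENNReal.ofReal (Real.exp (-v))) y := by
          intro y
          by_cases hy : b * D y ^ 2 < v
          · have : D y ≤ (v / b) ^ (1 / 2 : ℝ) := by
              rw [← Real.sqrt_eq_rpow]
              refine Real.le_sqrt_of_sq_le ?_
              rw [le_div_iff₀' hb]
              exact hy.le
            rw [indicator_of_mem (s := {y | D y ≤ (v / b) ^ (1 / 2 : ℝ)}) this]
            simp [hy]
          · simp [hy]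
        refine (lintegral_mono h2).trans ?_
        rw [lintegral_indicator_const (measurableSet_le hD measurable_const)]
        refine (mul_le_mul_right (h _ (by positivity)) _).trans_eq ?_
        rw [← ENNReal.ofReal_mul (by positivity), ← ENNReal.ofReal_mul (by positivity),
          ← Real.rpow_mul (by positivity), Real.div_rpow hv0.le hb.le, add_sub_cancel_right,
          one_mul, neg_div, Real.rpow_neg hb.le, show 1 / 2 * s = s / 2 by ring]
        congr 1
        ring
    _ = _ := by
        rw [lintegral_const_mul' _ _ ENNReal.ofReal_ne_top,
          lintegral_Ioi_rpow_mul_exp_neg_mul (by linarith) one_pos,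
          ← ENNReal.ofReal_mul (by positivity)]
        congr 1
        simp
        ring

variable {V : Type*} [NormedAddCommGroup V] [InnerProductSpace ℝ V] [FiniteDimensional ℝ V]
  [MeasurableSpace V] [BorelSpace V]

/-- Finiteness of energy integrals on the Fourier side. -/
theorem lintegral_charFun_sq_mul_weight_lt_top (ρ : Measure V) [IsFiniteMeasure ρ] {C s q : ℝ}
    (hC : 0 ≤ C) (hq : 0 < q) (hqs : (finrank ℝ V : ℝ) - s < q)
    (h : ∀ b : ℝ, 0 < b → ∫⁻ y, ∫⁻ z, ENNReal.ofReal (Real.exp (-b * ‖y - z‖ ^ 2)) ∂ρ ∂ρ ≤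
      ENNReal.ofReal (C * b ^ (-s / 2))) :
    ∫⁻ ζ : V, ENNReal.ofReal (‖charFun ρ ζ‖ ^ 2) *
      ENNReal.ofReal ((1 + ‖ζ‖ ^ 2) ^ (-q / 2)) < ∞ := by
  set n := finrank ℝ V
  have hcm : Measurable (fun ζ : V => ENNReal.ofReal (‖charFun ρ ζ‖ ^ 2)) :=
    (measurable_charFun.norm.pow_const 2).ennreal_ofReal
  have ha : 0 < q / 2 := by positivity
  have hG := Real.Gamma_pos_of_pos ha
  -- The Gamma integral writes the weight as a superposition of Gaussians `exp (-t‖ζ‖²)`, for which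
  -- duality returns the spatial energy at `b = 1 / (4t)`. The remaining `t`-integral converges at
  -- `0` because `q - n + s > 0`.
  have h1 : ENNReal.ofReal (Real.Gamma (q / 2)) * ∫⁻ ζ : V, ENNReal.ofReal (‖charFun ρ ζ‖ ^ 2) *
      ENNReal.ofReal ((1 + ‖ζ‖ ^ 2) ^ (-q / 2)) =
      ∫⁻ ζ : V, ∫⁻ t in Ioi (0 : ℝ), ENNReal.ofReal (‖charFun ρ ζ‖ ^ 2) *
        ENNReal.ofReal (t ^ (q / 2 - 1) * Real.exp (-((1 + ‖ζ‖ ^ 2) * t))) := by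
    rw [← lintegral_const_mul' _ _ ENNReal.ofReal_ne_top]
    refine lintegral_congr fun ζ => ?_
    have h0 : 0 < 1 + ‖ζ‖ ^ 2 := by positivity
    rw [lintegral_const_mul' _ _ ENNReal.ofReal_ne_top,
      lintegral_Ioi_rpow_mul_exp_neg_mul ha h0, mul_left_comm, ← ENNReal.ofReal_mul hG.le,
      one_div, Real.inv_rpow h0.le, neg_div, Real.rpow_neg h0.le, mul_comm (Real.Gamma _)]
  have h2 : ∫⁻ ζ : V, ∫⁻ t in Ioi (0 : ℝ), ENNReal.ofReal (‖charFun ρ ζ‖ ^ 2) *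
        ENNReal.ofReal (t ^ (q / 2 - 1) * Real.exp (-((1 + ‖ζ‖ ^ 2) * t))) =
      ∫⁻ t in Ioi (0 : ℝ), ∫⁻ ζ : V, ENNReal.ofReal (‖charFun ρ ζ‖ ^ 2) *
        ENNReal.ofReal (t ^ (q / 2 - 1) * Real.exp (-((1 + ‖ζ‖ ^ 2) * t))) := by
    refine lintegral_lintegral_swap (Measurable.aemeasurable ?_)
    refine (hcm.comp measurable_fst).mul ?_
    fun_prop
  have h3 : ∫⁻ t in Ioi (0 : ℝ), ∫⁻ ζ : V, ENNReal.ofReal (‖charFun ρ ζ‖ ^ 2) *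
        ENNReal.ofReal (t ^ (q / 2 - 1) * Real.exp (-((1 + ‖ζ‖ ^ 2) * t))) ≤
      ∫⁻ t in Ioi (0 : ℝ), ENNReal.ofReal (π ^ (n / 2 : ℝ) * (C * 4 ^ (s / 2))) *
        ENNReal.ofReal (t ^ ((q - n + s) / 2 - 1) * Real.exp (-(1 * t))) := by
    refine setLIntegral_mono' measurableSet_Ioi fun t ht => ?_
    have ht0 : 0 < t := ht
    have e1 : ∀ ζ : V, ENNReal.ofReal (‖charFun ρ ζ‖ ^ 2) *
        ENNReal.ofReal (t ^ (q / 2 - 1) * Real.exp (-((1 + ‖ζ‖ ^ 2) * t))) =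
        ENNReal.ofReal (t ^ (q / 2 - 1) * Real.exp (-t)) * (ENNReal.ofReal (‖charFun ρ ζ‖ ^ 2) *
          ENNReal.ofReal (Real.exp (-t * ‖ζ‖ ^ 2))) := by
      intro ζ
      rw [mul_left_comm, ← ENNReal.ofReal_mul (p := t ^ (q / 2 - 1) * Real.exp (-t))
        (by positivity), mul_assoc (t ^ (q / 2 - 1)), ← Real.exp_add]
      ring_nf
    simp_rw [e1]
    rw [lintegral_const_mul' _ _ ENNReal.ofReal_ne_top,
      lintegral_norm_sq_charFun_mul_gaussian ht0]
    have e2 : ∫⁻ y, ∫⁻ z, ENNReal.ofReal (Real.exp (-‖y - z‖ ^ 2 / (4 * t))) ∂ρ ∂ρ ≤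
        ENNReal.ofReal (C * (1 / (4 * t)) ^ (-s / 2)) := by
      refine le_trans (le_of_eq ?_) (h (1 / (4 * t)) (by positivity))
      refine lintegral_congr fun y => lintegral_congr fun z => ?_
      ring_nf
    calc _ ≤ ENNReal.ofReal (t ^ (q / 2 - 1) * Real.exp (-t)) *
          (ENNReal.ofReal ((π / t) ^ (n / 2 : ℝ)) *
            ENNReal.ofReal (C * (1 / (4 * t)) ^ (-s / 2))) := by gcongr
      _ = _ := by
        rw [← ENNReal.ofReal_mul (by positivity), ← ENNReal.ofReal_mul (by positivity),
          ← ENNReal.ofReal_mul (by positivity)]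
        congr 1
        have e3 : (1 / (4 * t)) ^ (-s / 2) = 4 ^ (s / 2) * t ^ (s / 2) := by
          rw [one_div, Real.inv_rpow (by positivity), neg_div, Real.rpow_neg (by positivity),
            inv_inv, Real.mul_rpow (by norm_num) ht0.le]
        have e4 : t ^ ((q - n + s) / 2 - 1) = t ^ (q / 2 - 1) * (t ^ (n / 2 : ℝ))⁻¹ * t ^ (s / 2) := by
          rw [← Real.rpow_neg ht0.le, ← Real.rpow_add ht0, ← Real.rpow_add ht0]
          ring_nf
        rw [e3, e4, Real.div_rpow Real.pi_pos.le ht0.le, one_mul]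
        ring
  have h4 : ∫⁻ t in Ioi (0 : ℝ), ENNReal.ofReal (π ^ (n / 2 : ℝ) * (C * 4 ^ (s / 2))) *
        ENNReal.ofReal (t ^ ((q - n + s) / 2 - 1) * Real.exp (-(1 * t))) < ∞ := by
    rw [lintegral_const_mul' _ _ ENNReal.ofReal_ne_top,
      lintegral_Ioi_rpow_mul_exp_neg_mul (by linarith) one_pos]
    exact ENNReal.mul_lt_top ENNReal.ofReal_lt_top ENNReal.ofReal_lt_top
  have h5 := (h1.trans h2).trans_lt (h3.trans_lt h4)
  exact ENNReal.lt_top_of_mul_ne_top_right h5.ne (ENNReal.ofReal_pos.2 hG).ne'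

end Energy

/-! ### Distributing mass down a tree -/

section Tree

open Set

/-- The mass distribution on the vertices of a tree (with parent map `p`), obtained from a
function `h` by splitting the mass of each vertex among its children proportionally to `h`,
starting with `h 0 z₀` at the root `z₀`. -/
noncomputable def treeMass {ι : Type*} [DecidableEq ι] (p : ι → ι) (h : ℕ → ι → ℝ≥0∞) (z₀ : ι) :
    ℕ → ι → ℝ≥0∞
  | 0, z => if z = z₀ then h 0 z₀ else 0
  | n + 1, z => treeMass p h z₀ n (p z) *
      (h (n + 1) z / ∑' y : p ⁻¹' {p z}, h (n + 1) y)

variable {ι : Type*} [DecidableEq ι] {p : ι → ι} {h : ℕ → ι → ℝ≥0∞} {z₀ : ι}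

/-- By subadditivity the ratio of a parent's mass to the total `h` of its children never exceeds
`1`. -/
theorem treeMass_le (hsub : ∀ n u, h n u ≤ ∑' y : p ⁻¹' {u}, h (n + 1) y) (n : ℕ) (z : ι) :
    treeMass p h z₀ n z ≤ h n z := by
  induction n generalizing z with
  | zero =>
    rw [treeMass]
    split_ifs with hz
    · rw [hz]
    · exact zero_le
  | succ n ih =>
    rw [treeMass, ← mul_div_assoc, mul_comm]
    refine ENNReal.div_le_of_le_mul ?_
    gcongr
    exact (ih (p z)).trans (hsub n (p z))

theorem tsum_treeMass_children (hsub : ∀ n u, h n u ≤ ∑' y : p ⁻¹' {u}, h (n + 1) y)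
    (hfin : ∀ n u, ∑' y : p ⁻¹' {u}, h (n + 1) y ≠ ∞) (n : ℕ) (u : ι) :
    ∑' y : p ⁻¹' {u}, treeMass p h z₀ (n + 1) y = treeMass p h z₀ n u := by
  have h1 : ∀ y : p ⁻¹' {u}, treeMass p h z₀ (n + 1) y =
      treeMass p h z₀ n u / (∑' y : p ⁻¹' {u}, h (n + 1) y) * h (n + 1) y := by
    rintro ⟨y, hy⟩
    have hy' : p y = u := hy
    rw [treeMass, hy', div_eq_mul_inv, div_eq_mul_inv]
    ring
  simp_rw [h1]
  rw [ENNReal.tsum_mul_left]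
  -- If the children have total `h` zero they receive nothing, but then the parent's mass is already
  -- zero.
  by_cases h0 : ∑' y : p ⁻¹' {u}, h (n + 1) y = 0
  · have h2 : treeMass p h z₀ n u = 0 :=
      le_antisymm ((treeMass_le hsub n u).trans ((hsub n u).trans h0.le)) zero_le
    rw [h2, h0, mul_zero]
  · exact ENNReal.div_mul_cancel h0 (hfin n u)

theorem tsum_treeMass_mul_iterate (hsub : ∀ n u, h n u ≤ ∑' y : p ⁻¹' {u}, h (n + 1) y)
    (hfin : ∀ n u, ∑' y : p ⁻¹' {u}, h (n + 1) y ≠ ∞) (F : ι → ℝ≥0∞) (n j : ℕ) :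
    ∑' z, treeMass p h z₀ (n + j) z * F (p^[j] z) = ∑' u, treeMass p h z₀ n u * F u := by
  induction j with
  | zero => simp
  | succ j ih =>
    rw [← ih, ← ENNReal.tsum_fiberwise _ p]
    refine tsum_congr fun u => ?_
    rw [← tsum_treeMass_children hsub hfin (n + j) u, ← ENNReal.tsum_mul_right]
    refine tsum_congr fun y => ?_
    rw [Function.iterate_succ_apply, show p y = u from y.2]
    rfl

end Tree

/-! ### Dyadic cubes, Hausdorff content and Frostman's lemma -/

section Frostman

open Filter Topology Set Metric

variable {d : ℕ}

/-- The dyadic cube of side `2 ^ (-n)` in `ℝ^d` with index `z`. -/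
def dyadicCube (n : ℕ) (z : Fin d → ℤ) : Set (EuclideanSpace ℝ (Fin d)) :=
  {x | ∀ i, ⌊(2 : ℝ) ^ n * x i⌋ = z i}

theorem floor_two_pow_mul_succ (n : ℕ) (a : ℝ) :
    ⌊(2 : ℝ) ^ (n + 1) * a⌋ / 2 = ⌊(2 : ℝ) ^ n * a⌋ := by
  have := Int.floor_div_natCast ((2 : ℝ) ^ (n + 1) * a) 2
  rw [Nat.cast_ofNat, Nat.cast_ofNat] at this
  rw [← this]
  congr 1
  rw [pow_succ]
  ring

theorem dyadicCube_succ_subset (n : ℕ) (z : Fin d → ℤ) :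
    dyadicCube (n + 1) z ⊆ dyadicCube n (fun i => z i / 2) := fun x hx i => by
  rw [← floor_two_pow_mul_succ, hx i]

theorem dyadicCube_add_subset (n j : ℕ) (z : Fin d → ℤ) :
    dyadicCube (n + j) z ⊆ dyadicCube n ((fun z i => z i / 2)^[j] z) := by
  induction j generalizing z with
  | zero => exact Subset.rfl
  | succ j ih =>
    rw [Function.iterate_succ_apply]
    exact (dyadicCube_succ_subset (n + j) z).trans (ih _)

theorem finite_preimage_half (u : Fin d → ℤ) :
    ((fun (z : Fin d → ℤ) i => z i / 2) ⁻¹' {u}).Finite := by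
  refine (Fintype.piFinset fun i => Finset.Icc (2 * u i) (2 * u i + 1)).finite_toSet.subset ?_
  intro z hz
  simp only [Finset.mem_coe, Fintype.mem_piFinset, Finset.mem_Icc]
  intro i
  have : z i / 2 = u i := congrFun hz i
  omega

theorem ediam_dyadicCube_le (n : ℕ) (z : Fin d → ℤ) :
    ediam (dyadicCube n z) ≤ ENNReal.ofReal (√d * (1 / 2) ^ n) := by
  refine ediam_le_of_forall_dist_le fun x hx y hy => ?_
  have hp : (0 : ℝ) < 2 ^ n := by positivity
  have h1 : ∀ i, dist (x i) (y i) ^ 2 ≤ ((1 / 2 : ℝ) ^ n) ^ 2 := by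
    intro i
    have h2 := Int.abs_sub_lt_one_of_floor_eq_floor ((hx i).trans (hy i).symm)
    rw [← mul_sub, abs_mul, abs_of_pos hp] at h2
    rw [Real.dist_eq, one_div, inv_pow]
    gcongr
    refine le_of_mul_le_mul_left ?_ hp
    rw [mul_inv_cancel₀ hp.ne']
    exact h2.le
  rw [EuclideanSpace.dist_eq]
  refine (Real.sqrt_le_sqrt (Finset.sum_le_sum fun i _ => h1 i)).trans_eq ?_
  rw [Finset.sum_const, Finset.card_univ, Fintype.card_fin, nsmul_eq_mul,
    Real.sqrt_mul (by positivity), Real.sqrt_sq (by positivity)]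

/-- Consequently a ball of radius `2 ^ (-n)` meets at most `3 ^ d` cubes of generation `n`. -/
theorem floor_mem_of_mem_ball {n : ℕ} {x y : EuclideanSpace ℝ (Fin d)}
    (h : y ∈ ball x ((1 / 2 : ℝ) ^ n)) (i : Fin d) :
    ⌊(2 : ℝ) ^ n * x i⌋ - 1 ≤ ⌊(2 : ℝ) ^ n * y i⌋ ∧
      ⌊(2 : ℝ) ^ n * y i⌋ ≤ ⌊(2 : ℝ) ^ n * x i⌋ + 1 := by
  have h1 : |y i - x i| ≤ (1 / 2 : ℝ) ^ n := by
    have := PiLp.norm_apply_le (y - x) i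
    rw [← dist_eq_norm] at this
    exact this.trans (mem_ball.1 h).le
  have hp : (0 : ℝ) < 2 ^ n := by positivity
  have h2 : |(2 : ℝ) ^ n * y i - 2 ^ n * x i| ≤ 1 := by
    rw [← mul_sub, abs_mul, abs_of_pos hp]
    calc (2 : ℝ) ^ n * |y i - x i| ≤ 2 ^ n * (1 / 2) ^ n := by gcongr
      _ = 1 := by rw [← mul_pow]; norm_num
  rw [abs_le] at h2
  constructor
  · rw [sub_le_iff_le_add, ← Int.floor_add_one]
    exact Int.floor_le_floor (by linarith)
  · rw [← Int.floor_add_one]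
    exact Int.floor_le_floor (by linarith)

/-- The unlimited `s`-dimensional Hausdorff content. -/
noncomputable def hausdorffContent (X : Type*) [EMetricSpace X] (s : ℝ) : OuterMeasure X :=
  OuterMeasure.boundedBy fun A => ediam A ^ s

theorem hausdorffMeasure_eq_zero_of_hausdorffContent {X : Type*} [EMetricSpace X]
    [MeasurableSpace X] [BorelSpace X] {s : ℝ} (hs : 0 < s) {A : Set X}
    (h : hausdorffContent X s A = 0) : Measure.hausdorffMeasure s A = 0 := by
  rw [Measure.hausdorffMeasure_apply]
  simp only [ENNReal.iSup_eq_zero]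
  intro r hr
  refine le_antisymm (le_of_forall_gt_imp_ge_of_dense fun ε hε => ?_) zero_le
  have hr' : 0 < r ^ s := ENNReal.rpow_pos_of_nonneg hr hs.le
  rw [hausdorffContent, OuterMeasure.boundedBy_apply] at h
  -- A covering sum below `r ^ s` forces each piece to have diameter at most `r`, so the cover is
  -- admissible at scale `r`.
  have h1 := h.trans_lt (lt_min hε hr')
  simp only [iInf_lt_iff] at h1
  obtain ⟨t, ht, hlt⟩ := h1
  refine iInf_le_of_le t (iInf_le_of_le ht (iInf_le_of_le (fun n => ?_)
    (hlt.le.trans (min_le_left _ _))))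
  rcases (t n).eq_empty_or_nonempty with h0 | h0
  · simp [h0]
  · have h2 : ediam (t n) ^ s ≤ r ^ s :=
      calc ediam (t n) ^ s = ⨆ _ : (t n).Nonempty, ediam (t n) ^ s := by simp [h0]
        _ ≤ _ := ENNReal.le_tsum n
        _ ≤ r ^ s := hlt.le.trans (min_le_right _ _)
    exact (ENNReal.rpow_le_rpow_iff hs).1 h2

/-- **Frostman's lemma** for compact subsets of Euclidean space. -/
theorem exists_frostman_measure {E : Set (EuclideanSpace ℝ (Fin d))} (hE : IsCompact E) {s : ℝ}
    (hs : 0 < s) (hpos : Measure.hausdorffMeasure s E ≠ 0) :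
    ∃ μ : Measure (EuclideanSpace ℝ (Fin d)), IsProbabilityMeasure μ ∧ μ Eᶜ = 0 ∧
      ∃ C : ℝ, 0 ≤ C ∧ ∀ x r, 0 < r → μ (closedBall x r) ≤ ENNReal.ofReal (C * r ^ s) := by
  set m := hausdorffContent (EuclideanSpace ℝ (Fin d)) s with hm
  have hmE : m E ≠ 0 := fun h => hpos (hausdorffMeasure_eq_zero_of_hausdorffContent hs h)
  set p : (Fin d → ℤ) → (Fin d → ℤ) := fun z i => z i / 2 with hp
  -- Content is both subadditive over children and at most `diam ^ s`: the first makes the tree mass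
  -- conserved, the second gives the Frostman bound at every scale.
  set h : ℕ → (Fin d → ℤ) → ℝ≥0∞ := fun n z => m (E ∩ dyadicCube n z) with hh
  have hle : ∀ n z, h n z ≤ ENNReal.ofReal ((√d * (1 / 2) ^ n) ^ s) := by
    intro n z
    rw [← ENNReal.ofReal_rpow_of_nonneg (by positivity) hs.le]
    refine (OuterMeasure.boundedBy_le _).trans (ENNReal.rpow_le_rpow ?_ hs.le)
    exact (ediam_mono inter_subset_right).trans (ediam_dyadicCube_le n z)
  have hsub : ∀ n u, h n u ≤ ∑' y : p ⁻¹' {u}, h (n + 1) y := by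
    intro n u
    have hcount : Countable (p ⁻¹' {u}) := inferInstance
    refine le_trans (measure_mono ?_) (measure_iUnion_le (μ := m)
      fun y : p ⁻¹' {u} => E ∩ dyadicCube (n + 1) (y : Fin d → ℤ))
    rintro x ⟨hxE, hx⟩
    refine mem_iUnion.2 ⟨⟨fun i => ⌊(2 : ℝ) ^ (n + 1) * x i⌋, ?_⟩, hxE, fun i => rfl⟩
    funext i
    rw [hp, ← hx i]
    exact floor_two_pow_mul_succ n (x i)
  have hfin : ∀ n u, ∑' y : p ⁻¹' {u}, h (n + 1) y ≠ ∞ := by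
    intro n u
    have := (finite_preimage_half u).fintype
    rw [tsum_fintype]
    exact ENNReal.sum_ne_top.2 fun y _ => ne_top_of_le_ne_top ENNReal.ofReal_ne_top (hle _ _)
  obtain ⟨z₀, hz₀⟩ : ∃ z₀, h 0 z₀ ≠ 0 := by
    by_contra! hcon
    refine hmE (le_antisymm ?_ zero_le)
    calc m E ≤ m (⋃ z, E ∩ dyadicCube 0 z) := measure_mono fun x hx =>
            mem_iUnion.2 ⟨fun i => ⌊(2 : ℝ) ^ 0 * x i⌋, hx, fun i => rfl⟩
      _ ≤ ∑' z, h 0 z := measure_iUnion_le _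
      _ = 0 := by simp [hcon]
  set H := h 0 z₀ with hH
  have hHtop : H ≠ ∞ := ne_top_of_le_ne_top ENNReal.ofReal_ne_top (hle _ _)
  set w := treeMass p h z₀ with hw
  have hwsum : ∀ n j (F : (Fin d → ℤ) → ℝ≥0∞), ∑' z, w (n + j) z * F (p^[j] z) = ∑' u, w n u * F u :=
    fun n j F => tsum_treeMass_mul_iterate hsub hfin F n j
  have hwtotal : ∀ n, ∑' z, w n z = H := by
    intro n
    have := hwsum 0 n (fun _ => 1)
    simp only [mul_one, zero_add] at this
    rw [this, tsum_eq_single z₀ (fun z hz => by simp [hw, treeMass, hz])]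
    simp [hw, treeMass, hH]
  have hEne : Nonempty E := by
    by_contra hcon
    rw [not_nonempty_iff, isEmpty_coe_sort] at hcon
    exact hmE (by rw [hcon, measure_empty])
  have : CompactSpace E := isCompact_iff_compactSpace.1 hE
  have hpt : ∀ n z, ∃ e : E, w n z ≠ 0 → (e : EuclideanSpace ℝ (Fin d)) ∈ dyadicCube n z := by
    intro n z
    by_cases hz : w n z = 0
    · exact ⟨hEne.some, fun h => (h hz).elim⟩
    · have h1 : h n z ≠ 0 := fun h0 => hz (le_antisymm ((treeMass_le hsub n z).trans h0.le) zero_le)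
      have h2 : (E ∩ dyadicCube n z).Nonempty := by
        by_contra h3
        rw [not_nonempty_iff_eq_empty] at h3
        exact h1 (by simp [hh, h3])
      exact ⟨⟨h2.some, h2.some_mem.1⟩, fun _ => h2.some_mem.2⟩
  choose e he using hpt
  set ν : ℕ → Measure E := fun n => H⁻¹ • Measure.sum fun z => w n z • Measure.dirac (e n z) with hν
  have hνprob : ∀ n, IsProbabilityMeasure (ν n) := fun n => ⟨by
    simp only [hν, Measure.smul_apply, Measure.sum_apply _ MeasurableSet.univ, smul_eq_mul,
      measure_univ, mul_one, hwtotal]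
    exact ENNReal.inv_mul_cancel hz₀ hHtop⟩
  -- The bound at scale `n` holds for every later discretisation, since mass is conserved from
  -- generation `n` to `n + j`. It therefore survives the limit.
  have hball : ∀ (x : EuclideanSpace ℝ (Fin d)) (n j : ℕ),
      ν (n + j) (Subtype.val ⁻¹' ball x ((1 / 2) ^ n)) ≤
        H⁻¹ * (3 ^ d * ENNReal.ofReal ((√d * (1 / 2) ^ n) ^ s)) := by
    intro x n j
    set N : Finset (Fin d → ℤ) := Fintype.piFinset fun i =>
      Finset.Icc (⌊(2 : ℝ) ^ n * x i⌋ - 1) (⌊(2 : ℝ) ^ n * x i⌋ + 1) with hN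
    have hNcard : N.card = 3 ^ d := by
      rw [hN, Fintype.card_piFinset]
      simp [show ∀ a : ℤ, a + 1 + 1 - (a - 1) = 3 from fun a => by ring]
    have hms : MeasurableSet ((Subtype.val : E → _) ⁻¹' ball x ((1 / 2 : ℝ) ^ n)) :=
      measurable_subtype_coe measurableSet_ball
    simp only [hν, Measure.smul_apply, Measure.sum_apply _ hms, smul_eq_mul]
    gcongr
    calc ∑' z, w (n + j) z * Measure.dirac (e (n + j) z) (Subtype.val ⁻¹' ball x ((1 / 2) ^ n))
        ≤ ∑' z, w (n + j) z * (N : Set (Fin d → ℤ)).indicator 1 (p^[j] z) := by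
          refine ENNReal.tsum_le_tsum fun z => ?_
          by_cases hz : w (n + j) z = 0
          · simp [hz]
          gcongr
          rw [Measure.dirac_apply' _ hms]
          by_cases ha : e (n + j) z ∈ (Subtype.val : E → _) ⁻¹' ball x ((1 / 2 : ℝ) ^ n)
          · have hmem : p^[j] z ∈ (N : Set (Fin d → ℤ)) := by
              simp only [hN, Finset.mem_coe, Fintype.mem_piFinset, Finset.mem_Icc]
              intro i
              have h1 : ⌊(2 : ℝ) ^ n * (e (n + j) z : EuclideanSpace ℝ (Fin d)) i⌋ = (p^[j] z) i :=
                dyadicCube_add_subset n j z (he (n + j) z hz) i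
              rw [← h1]
              exact floor_mem_of_mem_ball ha i
            rw [indicator_of_mem ha, indicator_of_mem hmem]
            rfl
          · rw [indicator_of_notMem ha]
            exact zero_le
      _ = ∑' u, w n u * (N : Set (Fin d → ℤ)).indicator 1 u := hwsum n j _
      _ = ∑ u ∈ N, w n u := by
          rw [tsum_eq_sum (s := N) (fun u hu => by simp [hu])]
          exact Finset.sum_congr rfl fun u hu => by simp [hu]
      _ ≤ ∑ u ∈ N, ENNReal.ofReal ((√d * (1 / 2) ^ n) ^ s) :=
          Finset.sum_le_sum fun u _ => (treeMass_le hsub n u).trans (hle n u)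
      _ = _ := by
          rw [Finset.sum_const, hNcard, nsmul_eq_mul]
          push_cast
          rfl
  set P : ℕ → ProbabilityMeasure E := fun n => ⟨ν n, hνprob n⟩ with hP
  -- Probability measures on the compact `E` form a compact space; an ultrafilter limit replaces a
  -- convergent subsequence.
  set L : Ultrafilter ℕ := hyperfilter ℕ with hL
  have hlim : Tendsto P L (𝓝 (L.map P).lim) := (L.map P).le_nhds_lim
  set μ := (L.map P).lim with hμ
  have hopen : ∀ (G : Set E), IsOpen G → ∀ (B : ℝ≥0∞) (n : ℕ), (∀ j, ν (n + j) G ≤ B) →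
      (μ : Measure E) G ≤ B := by
    intro G hG B n hB
    refine (ProbabilityMeasure.le_liminf_measure_open_of_tendsto hlim hG).trans ?_
    refine liminf_le_of_frequently_le' (Eventually.frequently ?_)
    have h1 : ∀ᶠ i in atTop, ν i G ≤ B := by
      filter_upwards [eventually_ge_atTop n] with i hi
      obtain ⟨j, rfl⟩ := Nat.exists_eq_add_of_le hi
      exact hB j
    exact Nat.hyperfilter_le_atTop h1
  refine ⟨(μ : Measure E).map Subtype.val, Measure.isProbabilityMeasure_map (by fun_prop), ?_, ?_⟩
  · rw [Measure.map_apply measurable_subtype_coe hE.isClosed.measurableSet.compl]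
    simp
  obtain ⟨c, hc0, hc⟩ : ∃ c : ℝ, 0 ≤ c ∧ H⁻¹ = ENNReal.ofReal c :=
    ⟨_, ENNReal.toReal_nonneg, (ENNReal.ofReal_toReal (ENNReal.inv_ne_top.2 hz₀)).symm⟩
  -- For small `r`, choose `n` with `2^(-n-1) < 2r ≤ 2^(-n)`: the closed ball fits in an open one
  -- and `2^(-n) ≤ 4r`. The term `2 ^ s` serves `2r > 1`, where total mass `1` suffices.
  refine ⟨c * 3 ^ d * (√d * 4) ^ s + 2 ^ s, by positivity, fun x r hr => ?_⟩
  rw [Measure.map_apply measurable_subtype_coe measurableSet_closedBall]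
  by_cases hr1 : 2 * r ≤ 1
  · obtain ⟨n, hn1, hn2⟩ := exists_nat_pow_near_of_lt_one (y := (1 / 2 : ℝ)) (x := 2 * r)
      (by positivity) hr1 (by norm_num) (by norm_num)
    have h1 := hopen (Subtype.val ⁻¹' ball x ((1 / 2 : ℝ) ^ n))
      (isOpen_ball.preimage continuous_subtype_val) _ n (fun j => hball x n j)
    refine (measure_mono (preimage_mono (closedBall_subset_ball ?_))).trans (h1.trans ?_)
    · linarith
    · rw [hc, show (3 : ℝ≥0∞) = ENNReal.ofReal 3 by norm_num,
        ← ENNReal.ofReal_pow (by norm_num), ← ENNReal.ofReal_mul (by positivity),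
        ← ENNReal.ofReal_mul (by positivity), add_mul]
      refine ENNReal.ofReal_le_ofReal (le_add_of_le_of_nonneg ?_ (by positivity))
      rw [mul_assoc, mul_assoc, ← Real.mul_rpow (by positivity) hr.le, mul_assoc √(d : ℝ)]
      gcongr
      rw [pow_succ] at hn1
      linarith
  · refine prob_le_one.trans ?_
    rw [ENNReal.one_le_ofReal, add_mul, ← Real.mul_rpow (by norm_num) hr.le]
    have : 1 ≤ (2 * r) ^ s := Real.one_le_rpow (by linarith) hs.le
    have : 0 ≤ c * 3 ^ d * (√d * 4) ^ s * r ^ s := by positivity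
    linarith

end Frostman

/-! ### Integration over product spaces one coordinate at a time -/

section PiIntegral

theorem lintegral_pi_eq_lintegral_insertNth {X : Type*} [MeasurableSpace X] (μ : Measure X)
    [SigmaFinite μ] {m : ℕ} (j : Fin (m + 1)) {f : (Fin (m + 1) → X) → ℝ≥0∞} (hf : Measurable f) :
    ∫⁻ x, f x ∂(Measure.pi fun _ => μ) =
      ∫⁻ b, ∫⁻ a, f (j.insertNth a b) ∂μ ∂(Measure.pi fun _ : Fin m => μ) := by
  have hmp := (measurePreserving_piFinSuccAbove (fun _ : Fin (m + 1) => μ) j).symm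
  rw [← hmp.lintegral_comp hf]
  exact lintegral_prod_symm' _ (hf.comp (MeasurableEquiv.measurable _))

theorem lintegral_pi_prod_eq_pow {X : Type*} [MeasurableSpace X] (μ : Measure X) [SigmaFinite μ]
    (m : ℕ) {g : X → ℝ≥0∞} (hg : Measurable g) :
    ∫⁻ b : Fin m → X, ∏ i, g (b i) ∂(Measure.pi fun _ => μ) = (∫⁻ a, g a ∂μ) ^ m := by
  induction m with
  | zero => simp
  | succ m ih =>
    rw [lintegral_pi_eq_lintegral_insertNth μ 0 (by fun_prop)]
    simp_rw [Fin.prod_univ_succ, Fin.insertNth_zero', Fin.cons_zero, Fin.cons_succ]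
    simp_rw [lintegral_mul_const _ hg]
    rw [lintegral_const_mul _ (by fun_prop), ih, pow_succ, mul_comm]

end PiIntegral

/-! ### Lifting to the paraboloid; Gaussian averages over pins -/

section Paraboloid

open Filter Topology Set Metric
open scoped RealInnerProductSpace Real

variable {d : ℕ}

/-- The point of the paraboloid in `ℝ^{d+1}` above `y`. -/
noncomputable def paraboloidLift (y : EuclideanSpace ℝ (Fin d)) : EuclideanSpace ℝ (Fin (d + 1)) :=
  WithLp.toLp 2 (Fin.cons (‖y‖ ^ 2) y.ofLp)

/-- The covector of `ℝ^{d+1}` whose pairing with the paraboloid is the (normalised) squared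
distance to `x`. -/
noncomputable def pinVector (x : EuclideanSpace ℝ (Fin d)) : EuclideanSpace ℝ (Fin (d + 1)) :=
  WithLp.toLp 2 (Fin.cons 1 (fun i => -2 * x i))

theorem inner_pinVector_paraboloidLift (x y : EuclideanSpace ℝ (Fin d)) :
    ⟪pinVector x, paraboloidLift y⟫ = ‖x - y‖ ^ 2 - ‖x‖ ^ 2 := by
  rw [norm_sub_sq_real]
  simp only [pinVector, paraboloidLift, PiLp.inner_apply, Fin.sum_univ_succ, Fin.cons_zero,
    Fin.cons_succ, RCLike.inner_apply, conj_trivial]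
  rw [show ∑ i, y.ofLp i * (-2 * x.ofLp i) = -2 * ∑ i, y.ofLp i * x.ofLp i by
    rw [Finset.mul_sum]; exact Finset.sum_congr rfl fun i _ => by ring]
  ring

theorem continuous_paraboloidLift : Continuous (paraboloidLift (d := d)) := by
  refine (PiLp.continuous_toLp 2 _).comp (continuous_pi fun i => ?_)
  refine Fin.cases ?_ (fun i => ?_) i
  · simp only [Fin.cons_zero]; fun_prop
  · simp only [Fin.cons_succ]; fun_prop

theorem continuous_pinVector : Continuous (pinVector (d := d)) := by
  refine (PiLp.continuous_toLp 2 _).comp (continuous_pi fun i => ?_)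
  refine Fin.cases ?_ (fun i => ?_) i
  · simp only [Fin.cons_zero]; fun_prop
  · simp only [Fin.cons_succ]; fun_prop

theorem norm_sq_eq_head_add_tail (ζ : EuclideanSpace ℝ (Fin (d + 1))) :
    ‖ζ‖ ^ 2 = ζ 0 ^ 2 + ‖(WithLp.toLp 2 (fun i => ζ (Fin.succ i)) : EuclideanSpace ℝ (Fin d))‖ ^ 2 := by
  rw [EuclideanSpace.norm_sq_eq, EuclideanSpace.norm_sq_eq, Fin.sum_univ_succ]
  simp

/-- The lift is the identity in the tail coordinates. Hence the lifted measure inherits the energy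
bound of `μ`. -/
theorem norm_sub_le_norm_paraboloidLift_sub (y z : EuclideanSpace ℝ (Fin d)) :
    ‖y - z‖ ^ 2 ≤ ‖paraboloidLift y - paraboloidLift z‖ ^ 2 := by
  rw [norm_sq_eq_head_add_tail (paraboloidLift y - paraboloidLift z)]
  refine le_add_of_nonneg_of_le (sq_nonneg _) (le_of_eq ?_)
  rw [EuclideanSpace.norm_sq_eq, EuclideanSpace.norm_sq_eq]
  simp [paraboloidLift]

/-- The linear combination of the covectors of the pins `x` with coefficients `τ`. -/
noncomputable def pinCombination {k : ℕ} (τ : Fin k → ℝ)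
    (x : Fin k → EuclideanSpace ℝ (Fin d)) : EuclideanSpace ℝ (Fin (d + 1)) :=
  ∑ i, τ i • pinVector (x i)

theorem continuous_pinCombination {k : ℕ} :
    Continuous fun p : (Fin k → ℝ) × (Fin k → EuclideanSpace ℝ (Fin d)) =>
      pinCombination p.1 p.2 := by
  refine continuous_finsetSum _ fun i _ => ?_
  exact (by fun_prop : Continuous fun p : (Fin k → ℝ) × (Fin k → EuclideanSpace ℝ (Fin d)) =>
    p.1 i).smul (continuous_pinVector.comp (by fun_prop))

theorem norm_sq_smul_pinVector_add (t : ℝ) (x : EuclideanSpace ℝ (Fin d))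
    (ζ : EuclideanSpace ℝ (Fin (d + 1))) :
    ‖t • pinVector x + ζ‖ ^ 2 = (t + ζ 0) ^ 2 + ‖(-2 * t) • x +
      (WithLp.toLp 2 (fun i => ζ (Fin.succ i)) : EuclideanSpace ℝ (Fin d))‖ ^ 2 := by
  rw [norm_sq_eq_head_add_tail]
  congr 2
  · simp [pinVector]
  · congr 1
    ext i
    simp [pinVector]
    ring

/-- For `|t| > 1` the integrand is a Gaussian in `x` of width `1 / |t|`, to which the Frostman bound
applies; for `|t| ≤ 1` total mass `1` suffices. The factor `2 ^ s` pays for replacing `|t|` by `1 +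
|t|`. -/
theorem lintegral_exp_neg_norm_smul_add_sq_le (μ : Measure (EuclideanSpace ℝ (Fin d)))
    [IsProbabilityMeasure μ] {C s : ℝ} (hC : 0 ≤ C) (hs : 0 ≤ s)
    (h : ∀ x r, 0 < r → μ (closedBall x r) ≤ ENNReal.ofReal (C * r ^ s)) (t : ℝ)
    (p : EuclideanSpace ℝ (Fin d)) :
    ∫⁻ x, ENNReal.ofReal (Real.exp (-(1 / 4) * ‖(-2 * t) • x + p‖ ^ 2)) ∂μ ≤
      ENNReal.ofReal (2 ^ s * (1 + C * Real.Gamma (s / 2 + 1)) * (1 + |t|) ^ (-s)) := by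
  have hG : 0 < Real.Gamma (s / 2 + 1) := Real.Gamma_pos_of_pos (by positivity)
  have h2 : ∀ u : ℝ, 0 < u → 1 + |t| ≤ 2 * u → u ^ (-s) ≤ 2 ^ s * (1 + |t|) ^ (-s) := by
    intro u hu hle
    calc u ^ (-s) = 2 ^ s * (2 * u) ^ (-s) := by
          rw [Real.mul_rpow (by norm_num) hu.le, ← mul_assoc, ← Real.rpow_add (by norm_num)]
          simp
      _ ≤ _ := by
          refine mul_le_mul_of_nonneg_left ?_ (by positivity)
          exact Real.rpow_le_rpow_of_nonpos (by positivity) hle (by linarith)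
  by_cases ht : |t| ≤ 1
  · calc _ ≤ ∫⁻ x, 1 ∂μ := by
          refine lintegral_mono fun x => ?_
          rw [ENNReal.ofReal_le_one, Real.exp_le_one_iff]
          have : 0 ≤ ‖(-2 * t) • x + p‖ ^ 2 := by positivity
          linarith
      _ = 1 := by simp
      _ ≤ _ := by
          rw [ENNReal.one_le_ofReal]
          have h3 := h2 1 one_pos (by linarith)
          rw [Real.one_rpow] at h3
          have h4 : 1 ≤ 1 + C * Real.Gamma (s / 2 + 1) := by
            have : 0 ≤ C * Real.Gamma (s / 2 + 1) := by positivity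
            linarith
          calc (1 : ℝ) ≤ (2 ^ s * (1 + |t|) ^ (-s)) * (1 + C * Real.Gamma (s / 2 + 1)) :=
                one_le_mul_of_one_le_of_one_le h3 h4
            _ = _ := by ring
  · push Not at ht
    have ht0 : t ≠ 0 := by
      rintro rfl
      simp at ht
      linarith
    have e1 : ∀ x, -(1 / 4) * ‖(-2 * t) • x + p‖ ^ 2 = -(t ^ 2) * dist x ((1 / (2 * t)) • p) ^ 2 := by
      intro x
      have : (-2 * t) • x + p = (-2 * t) • (x - (1 / (2 * t)) • p) := by
        rw [smul_sub, smul_smul]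
        have : -2 * t * (1 / (2 * t)) = -1 := by field_simp
        rw [this]
        simp
      rw [this, norm_smul, mul_pow, dist_eq_norm, Real.norm_eq_abs, sq_abs]
      ring
    simp_rw [e1]
    refine (lintegral_exp_neg_mul_sq_le μ (D := fun x => dist x ((1 / (2 * t)) • p))
      (by fun_prop) hC hs (fun r hr => h _ r hr) (by positivity)).trans ?_
    refine ENNReal.ofReal_le_ofReal ?_
    have e2 : (t ^ 2) ^ (-s / 2) = |t| ^ (-s) := by
      rw [← sq_abs, ← Real.rpow_natCast, ← Real.rpow_mul (abs_nonneg t)]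
      congr 1
      push_cast
      ring
    rw [e2]
    calc _ ≤ C * Real.Gamma (s / 2 + 1) * (2 ^ s * (1 + |t|) ^ (-s)) := by
          gcongr
          exact h2 |t| (by positivity) (by linarith)
      _ ≤ (1 + C * Real.Gamma (s / 2 + 1)) * (2 ^ s * (1 + |t|) ^ (-s)) := by
          gcongr
          linarith
      _ = _ := by ring

theorem lintegral_exp_neg_norm_pinCombination_sub_sq_le (μ : Measure (EuclideanSpace ℝ (Fin d)))
    [IsProbabilityMeasure μ] {C s : ℝ} (hC : 0 ≤ C) (hs : 0 ≤ s)
    (h : ∀ x r, 0 < r → μ (closedBall x r) ≤ ENNReal.ofReal (C * r ^ s)) {m : ℕ}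
    (τ : Fin (m + 1) → ℝ) (ζ : EuclideanSpace ℝ (Fin (d + 1))) :
    ∫⁻ x, ENNReal.ofReal (Real.exp (-(1 / 4) * ‖pinCombination τ x - ζ‖ ^ 2))
        ∂(Measure.pi fun _ => μ) ≤
      ENNReal.ofReal (2 ^ s * (1 + C * Real.Gamma (s / 2 + 1)) * (1 + ‖τ‖) ^ (-s) *
        Real.exp (-(1 / 4) * (∑ i, τ i - ζ 0) ^ 2)) := by
  have hG : 0 < Real.Gamma (s / 2 + 1) := Real.Gamma_pos_of_pos (by positivity)
  -- Only the pin with the largest coefficient is integrated; the others are frozen. The head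
  -- coordinate `∑ τ_i` does not involve the pins, so its Gaussian factor comes out unchanged.
  obtain ⟨j, hj⟩ := Finite.exists_max fun i => ‖τ i‖
  have hτ : ‖τ‖ ≤ |τ j| := (pi_norm_le_iff_of_nonneg (norm_nonneg _)).2 hj
  have hmeas : Measurable fun x : Fin (m + 1) → EuclideanSpace ℝ (Fin d) =>
      ENNReal.ofReal (Real.exp (-(1 / 4) * ‖pinCombination τ x - ζ‖ ^ 2)) := by
    have : Continuous fun x : Fin (m + 1) → EuclideanSpace ℝ (Fin d) => pinCombination τ x :=
      continuous_pinCombination.comp (Continuous.prodMk continuous_const continuous_id)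
    fun_prop
  rw [lintegral_pi_eq_lintegral_insertNth μ j hmeas]
  calc _ ≤ ∫⁻ _, ENNReal.ofReal (2 ^ s * (1 + C * Real.Gamma (s / 2 + 1)) * (1 + ‖τ‖) ^ (-s) *
        Real.exp (-(1 / 4) * (∑ i, τ i - ζ 0) ^ 2)) ∂(Measure.pi fun _ : Fin m => μ) := by
        refine lintegral_mono fun b => ?_
        set ζ' : EuclideanSpace ℝ (Fin (d + 1)) :=
          ∑ i, τ (j.succAbove i) • pinVector (b i) - ζ with hζ'
        have hζ0 : τ j + ζ' 0 = ∑ i, τ i - ζ 0 := by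
          rw [Fin.sum_univ_succAbove _ j]
          simp [hζ', pinVector]
          ring
        have e1 : ∀ a, pinCombination τ (j.insertNth a b) - ζ =
            τ j • pinVector a + ζ' := by
          intro a
          rw [pinCombination, Fin.sum_univ_succAbove _ j, hζ']
          simp [add_sub_assoc]
        simp_rw [e1, norm_sq_smul_pinVector_add, mul_add (-(1 / 4) : ℝ), Real.exp_add]
        rw [hζ0]
        simp_rw [ENNReal.ofReal_mul (Real.exp_pos _).le]
        rw [lintegral_const_mul' _ _ ENNReal.ofReal_ne_top, mul_comm (ENNReal.ofReal _)]
        rw [ENNReal.ofReal_mul (by positivity)]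
        gcongr
        refine (lintegral_exp_neg_norm_smul_add_sq_le μ hC hs h (τ j) _).trans ?_
        refine ENNReal.ofReal_le_ofReal ?_
        refine mul_le_mul_of_nonneg_left ?_ (by positivity)
        exact Real.rpow_le_rpow_of_nonpos (by positivity) (by linarith) (by linarith)
    _ = _ := by simp

/-- A Peetre type inequality for Gaussians. -/
theorem exp_neg_half_norm_sub_sq_le {V : Type*} [NormedAddCommGroup V] {q : ℝ} (hq : 0 ≤ q)
    (u ζ : V) :
    Real.exp (-(1 / 2) * ‖u - ζ‖ ^ 2) ≤ Real.exp (q ^ 2) * (1 + ‖u‖) ^ q *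
      (1 + ‖ζ‖ ^ 2) ^ (-q / 2) * Real.exp (-(1 / 4) * ‖u - ζ‖ ^ 2) := by
  have h1 : (1 + ‖ζ‖ ^ 2) ^ (q / 2) ≤ (1 + ‖u‖) ^ q * (1 + ‖u - ζ‖) ^ q := by
    have h2 : 1 + ‖ζ‖ ^ 2 ≤ (1 + ‖ζ‖) ^ 2 := by
      have := norm_nonneg ζ
      nlinarith
    have h3 : 1 + ‖ζ‖ ≤ (1 + ‖u‖) * (1 + ‖u - ζ‖) := by
      have h4 : ‖ζ‖ ≤ ‖u‖ + ‖u - ζ‖ := by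
        have := norm_sub_le u (u - ζ)
        rwa [sub_sub_cancel] at this
      have := mul_nonneg (norm_nonneg u) (norm_nonneg (u - ζ))
      nlinarith
    calc (1 + ‖ζ‖ ^ 2) ^ (q / 2) ≤ ((1 + ‖ζ‖) ^ 2) ^ (q / 2) :=
          Real.rpow_le_rpow (by positivity) h2 (by positivity)
      _ = (1 + ‖ζ‖) ^ q := by
          rw [← Real.rpow_natCast, ← Real.rpow_mul (by positivity)]
          congr 1
          push_cast
          ring
      _ ≤ ((1 + ‖u‖) * (1 + ‖u - ζ‖)) ^ q := Real.rpow_le_rpow (by positivity) h3 hq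
      _ = _ := Real.mul_rpow (by positivity) (by positivity)
  -- Half of the Gaussian absorbs the polynomial factor, using `q x - x² / 4 ≤ q²`.
  have h5 : (1 + ‖u - ζ‖) ^ q * Real.exp (-(1 / 4) * ‖u - ζ‖ ^ 2) ≤ Real.exp (q ^ 2) := by
    calc _ ≤ (Real.exp ‖u - ζ‖) ^ q * Real.exp (-(1 / 4) * ‖u - ζ‖ ^ 2) := by
          gcongr
          rw [add_comm]
          exact Real.add_one_le_exp _
      _ ≤ _ := by
          rw [← Real.exp_mul, ← Real.exp_add, Real.exp_le_exp]
          nlinarith [sq_nonneg (‖u - ζ‖ - 2 * q)]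
  have h6 : 0 < (1 + ‖ζ‖ ^ 2) ^ (q / 2) := by positivity
  rw [neg_div, Real.rpow_neg (by positivity)]
  calc Real.exp (-(1 / 2) * ‖u - ζ‖ ^ 2)
      = ((1 + ‖ζ‖ ^ 2) ^ (q / 2)) * ((1 + ‖ζ‖ ^ 2) ^ (q / 2))⁻¹ *
        (Real.exp (-(1 / 4) * ‖u - ζ‖ ^ 2) * Real.exp (-(1 / 4) * ‖u - ζ‖ ^ 2)) := by
        rw [mul_inv_cancel₀ h6.ne', one_mul, ← Real.exp_add]
        ring_nf
    _ ≤ ((1 + ‖u‖) ^ q * (1 + ‖u - ζ‖) ^ q) * ((1 + ‖ζ‖ ^ 2) ^ (q / 2))⁻¹ *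
        (Real.exp (-(1 / 4) * ‖u - ζ‖ ^ 2) * Real.exp (-(1 / 4) * ‖u - ζ‖ ^ 2)) := by gcongr
    _ = ((1 + ‖u - ζ‖) ^ q * Real.exp (-(1 / 4) * ‖u - ζ‖ ^ 2)) * ((1 + ‖u‖) ^ q *
        ((1 + ‖ζ‖ ^ 2) ^ (q / 2))⁻¹ * Real.exp (-(1 / 4) * ‖u - ζ‖ ^ 2)) := by ring
    _ ≤ Real.exp (q ^ 2) * ((1 + ‖u‖) ^ q *
        ((1 + ‖ζ‖ ^ 2) ^ (q / 2))⁻¹ * Real.exp (-(1 / 4) * ‖u - ζ‖ ^ 2)) := by gcongr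
    _ = _ := by ring

/-- Integrating `τ 0` against the Gaussian costs a constant independent of `a`, so decay is needed
only in the other `m` variables. An exponent `p > 1` with `p * m ≤ r` lets the sup-norm weight be
split into `m` integrable one-variable weights. -/
theorem exists_lintegral_weight_mul_gaussian_sum_le {m : ℕ} {r : ℝ} (hr : (m : ℝ) < r) :
    ∃ D : ℝ≥0∞, D ≠ ∞ ∧ ∀ a : ℝ, ∫⁻ τ : Fin (m + 1) → ℝ, ENNReal.ofReal ((1 + ‖τ‖) ^ (-r) *
      Real.exp (-(1 / 4) * (∑ i, τ i - a) ^ 2)) ≤ D := by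
  obtain ⟨p, hp1, hpm⟩ : ∃ p : ℝ, 1 < p ∧ p * m ≤ r := by
    have hm : (0 : ℝ) < m + 1 := by positivity
    refine ⟨1 + (r - m) / (m + 1), by
      have : 0 < (r - m) / (m + 1) := div_pos (by linarith) hm
      linarith, ?_⟩
    have h1 : (r - m) / (m + 1) * m ≤ r - m := by
      rw [div_mul_eq_mul_div, div_le_iff₀ hm]
      nlinarith
    linarith
  have hp0 : 0 ≤ p := by linarith
  set G : ℝ≥0∞ := ∫⁻ t : ℝ, ENNReal.ofReal (Real.exp (-(1 / 4) * t ^ 2)) with hGdef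
  set W : ℝ≥0∞ := ∫⁻ t : ℝ, ENNReal.ofReal ((1 + ‖t‖) ^ (-p)) with hWdef
  have hG : G ≠ ∞ := by
    have := (integrable_exp_neg_mul_sq (b := 1 / 4) (by norm_num))
    exact this.lintegral_lt_top.ne
  have hW : W ≠ ∞ :=
    (integrable_one_add_norm (E := ℝ) (μ := volume) (r := p) (by simpa using hp1)).lintegral_lt_top.ne
  refine ⟨W ^ m * G, ENNReal.mul_ne_top (ENNReal.pow_ne_top hW) hG, fun a => ?_⟩
  have hle : ∀ τ : Fin (m + 1) → ℝ, ENNReal.ofReal ((1 + ‖τ‖) ^ (-r) *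
      Real.exp (-(1 / 4) * (∑ i, τ i - a) ^ 2)) ≤
      (∏ i : Fin m, ENNReal.ofReal ((1 + ‖τ i.succ‖) ^ (-p))) *
        ENNReal.ofReal (Real.exp (-(1 / 4) * (τ 0 + (∑ i : Fin m, τ i.succ - a)) ^ 2)) := by
    intro τ
    rw [ENNReal.ofReal_mul (by positivity), Fin.sum_univ_succ, add_sub_assoc,
      ← ENNReal.ofReal_prod_of_nonneg fun i _ => by positivity]
    gcongr
    calc (1 + ‖τ‖) ^ (-r) ≤ (1 + ‖τ‖) ^ (-p * m) :=
          Real.rpow_le_rpow_of_exponent_le (by simp) (by linarith)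
      _ = ∏ i : Fin m, (1 + ‖τ‖) ^ (-p) := by
          rw [Finset.prod_const, Finset.card_univ, Fintype.card_fin, Real.rpow_mul (by positivity),
            Real.rpow_natCast]
      _ ≤ _ := by
          refine Finset.prod_le_prod (fun i _ => by positivity) fun i _ => ?_
          exact Real.rpow_le_rpow_of_nonpos (by positivity)
            (by simpa using norm_le_pi_norm τ i.succ) (by linarith)
  refine (lintegral_mono hle).trans ?_
  have hmeas : Measurable fun τ : Fin (m + 1) → ℝ =>
      (∏ i : Fin m, ENNReal.ofReal ((1 + ‖τ i.succ‖) ^ (-p))) *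
        ENNReal.ofReal (Real.exp (-(1 / 4) * (τ 0 + (∑ i : Fin m, τ i.succ - a)) ^ 2)) := by
    fun_prop
  rw [volume_pi, lintegral_pi_eq_lintegral_insertNth volume 0 hmeas]
  refine le_of_eq ?_
  simp_rw [Fin.insertNth_zero', Fin.cons_zero, Fin.cons_succ]
  calc _ = ∫⁻ b : Fin m → ℝ, (∏ i : Fin m, ENNReal.ofReal ((1 + ‖b i‖) ^ (-p))) * G
        ∂(Measure.pi fun _ => volume) := by
        refine lintegral_congr fun b => ?_
        rw [lintegral_const_mul _ (by fun_prop)]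
        congr 1
        exact lintegral_add_right_eq_self (μ := (volume : Measure ℝ))
          (fun t => ENNReal.ofReal (Real.exp (-(1 / 4) * t ^ 2))) _
    _ = _ := by
        rw [lintegral_mul_const _ (by fun_prop), lintegral_pi_prod_eq_pow volume m
          (g := fun t => ENNReal.ofReal ((1 + ‖t‖) ^ (-p))) (by fun_prop)]

end Paraboloid

/-! ### The mean-square estimate and laws of distances to pins -/

section PinnedProjection

open Filter Topology Set Metric
open scoped RealInnerProductSpace Real

variable {d : ℕ}

/-- Combinations have norm at most `(m + 1) R ‖τ‖`, so the Peetre inequality buys decay in `ζ` at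
the price `(1 + ‖τ‖) ^ q`. What remains of the Frostman gain is `(1 + ‖τ‖) ^ (-(s - q))` on a slab,
whence the condition `m < s - q`. -/
theorem exists_lintegral_gaussian_pinCombination_le (μ : Measure (EuclideanSpace ℝ (Fin d)))
    [IsProbabilityMeasure μ] {C s q R : ℝ} (hC : 0 ≤ C) (hs : 0 ≤ s) (hq : 0 ≤ q) (hR : 0 ≤ R)
    (h : ∀ x r, 0 < r → μ (closedBall x r) ≤ ENNReal.ofReal (C * r ^ s))
    (hμ : ∀ᵐ x ∂μ, ‖pinVector x‖ ≤ R) {m : ℕ} (hm : (m : ℝ) < s - q) :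
    ∃ K : ℝ≥0∞, K ≠ ∞ ∧ ∀ ζ : EuclideanSpace ℝ (Fin (d + 1)),
      ∫⁻ τ : Fin (m + 1) → ℝ, ∫⁻ x, ENNReal.ofReal
        (Real.exp (-(1 / 2) * ‖pinCombination τ x - ζ‖ ^ 2)) ∂(Measure.pi fun _ => μ) ≤
      K * ENNReal.ofReal ((1 + ‖ζ‖ ^ 2) ^ (-q / 2)) := by
  have hG : 0 < Real.Gamma (s / 2 + 1) := Real.Gamma_pos_of_pos (by positivity)
  obtain ⟨D, hD, hDle⟩ := exists_lintegral_weight_mul_gaussian_sum_le hm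
  set A : ℝ := 2 ^ s * (1 + C * Real.Gamma (s / 2 + 1)) with hA
  have hA0 : 0 ≤ A := by positivity
  set B : ℝ := Real.exp (q ^ 2) * (1 + (m + 1) * R) ^ q with hB
  have hB0 : 0 ≤ B := by positivity
  have hae : ∀ᵐ x ∂(Measure.pi fun _ : Fin (m + 1) => μ), ∀ i, ‖pinVector (x i)‖ ≤ R :=
    ae_all_iff.2 fun i => (Measure.quasiMeasurePreserving_eval (fun _ => μ) i).ae hμ
  refine ⟨ENNReal.ofReal (B * A) * D, ENNReal.mul_ne_top ENNReal.ofReal_ne_top hD, fun ζ => ?_⟩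
  have hstep : ∀ τ : Fin (m + 1) → ℝ, ∫⁻ x, ENNReal.ofReal
        (Real.exp (-(1 / 2) * ‖pinCombination τ x - ζ‖ ^ 2)) ∂(Measure.pi fun _ => μ) ≤
      ENNReal.ofReal (B * A * (1 + ‖ζ‖ ^ 2) ^ (-q / 2)) * ENNReal.ofReal ((1 + ‖τ‖) ^ (-(s - q)) *
        Real.exp (-(1 / 4) * (∑ i, τ i - ζ 0) ^ 2)) := by
    intro τ
    calc _ ≤ ∫⁻ x, ENNReal.ofReal (B * (1 + ‖τ‖) ^ q * (1 + ‖ζ‖ ^ 2) ^ (-q / 2)) *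
          ENNReal.ofReal (Real.exp (-(1 / 4) * ‖pinCombination τ x - ζ‖ ^ 2))
            ∂(Measure.pi fun _ => μ) := by
          refine lintegral_mono_ae ?_
          filter_upwards [hae] with x hx
          rw [← ENNReal.ofReal_mul (by positivity)]
          refine ENNReal.ofReal_le_ofReal ((exp_neg_half_norm_sub_sq_le hq _ ζ).trans ?_)
          have h1 : ‖pinCombination τ x‖ ≤ (m + 1) * (‖τ‖ * R) := by
            refine (norm_sum_le _ _).trans ?_
            calc ∑ i, ‖τ i • pinVector (x i)‖ ≤ ∑ _i : Fin (m + 1), ‖τ‖ * R := by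
                  refine Finset.sum_le_sum fun i _ => ?_
                  rw [norm_smul]
                  gcongr
                  · exact norm_le_pi_norm τ i
                  · exact hx i
              _ = _ := by simp
          have h2 : 1 + ‖pinCombination τ x‖ ≤ (1 + (m + 1) * R) * (1 + ‖τ‖) := by
            have : 0 ≤ (m + 1) * R := by positivity
            have := norm_nonneg τ
            nlinarith
          have h3 : (1 + ‖pinCombination τ x‖) ^ q ≤ (1 + (m + 1) * R) ^ q * (1 + ‖τ‖) ^ q := by
            rw [← Real.mul_rpow (by positivity) (by positivity)]
            exact Real.rpow_le_rpow (by positivity) h2 hq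
          calc _ ≤ Real.exp (q ^ 2) * ((1 + (m + 1) * R) ^ q * (1 + ‖τ‖) ^ q) *
                (1 + ‖ζ‖ ^ 2) ^ (-q / 2) * Real.exp (-(1 / 4) * ‖pinCombination τ x - ζ‖ ^ 2) := by
                gcongr
            _ = _ := by rw [hB]; ring
      _ ≤ ENNReal.ofReal (B * (1 + ‖τ‖) ^ q * (1 + ‖ζ‖ ^ 2) ^ (-q / 2)) *
          ENNReal.ofReal (A * (1 + ‖τ‖) ^ (-s) * Real.exp (-(1 / 4) * (∑ i, τ i - ζ 0) ^ 2)) := by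
          rw [lintegral_const_mul' _ _ ENNReal.ofReal_ne_top]
          gcongr
          exact lintegral_exp_neg_norm_pinCombination_sub_sq_le μ hC hs h τ ζ
      _ = _ := by
          rw [← ENNReal.ofReal_mul (by positivity), ← ENNReal.ofReal_mul (by positivity),
            neg_sub, sub_eq_add_neg q s, Real.rpow_add (by positivity)]
          congr 1
          ring
  refine (lintegral_mono hstep).trans ?_
  rw [lintegral_const_mul' _ _ ENNReal.ofReal_ne_top, ENNReal.ofReal_mul (by positivity)]
  calc _ ≤ ENNReal.ofReal (B * A) * ENNReal.ofReal ((1 + ‖ζ‖ ^ 2) ^ (-q / 2)) * D := by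
        gcongr
        exact hDle (ζ 0)
    _ = _ := by ring

theorem lintegral_charFun_map_paraboloidLift_ne_top (μ : Measure (EuclideanSpace ℝ (Fin d)))
    [IsProbabilityMeasure μ] {C s : ℝ} (hC : 0 ≤ C)
    (h : ∀ x r, 0 < r → μ (closedBall x r) ≤ ENNReal.ofReal (C * r ^ s))
    {E : Set (EuclideanSpace ℝ (Fin d))} (hE : IsCompact E) (hμE : μ Eᶜ = 0)
    {m : ℕ} (hmd : m ≤ d) (hm : ((d : ℝ) + (m + 1)) / 2 < s) :
    ∫⁻ x, (∫⁻ τ : Fin (m + 1) → ℝ,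
      ENNReal.ofReal (‖charFun (μ.map paraboloidLift) (pinCombination τ x)‖ ^ 2))
        ∂(Measure.pi fun _ => μ) ≠ ∞ := by
  have hs : 0 ≤ s := le_trans (by positivity) hm.le
  have hG : 0 < Real.Gamma (s / 2 + 1) := Real.Gamma_pos_of_pos (by positivity)
  have hEae : ∀ᵐ x ∂μ, x ∈ E := hμE
  have hlm : Measurable (paraboloidLift (d := d)) := continuous_paraboloidLift.measurable
  obtain ⟨R, hR⟩ := (hE.image continuous_pinVector).isBounded.exists_norm_le
  obtain ⟨R', hR'⟩ := (hE.image continuous_paraboloidLift).isBounded.exists_norm_le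
  have hRae : ∀ᵐ x ∂μ, ‖pinVector x‖ ≤ max R 0 := by
    filter_upwards [hEae] with x hx
    exact (hR _ (mem_image_of_mem _ hx)).trans (le_max_left _ _)
  -- The midpoint of the admissible interval `(d + 1 - s, s - m)`; it is positive because `m ≤ d`.
  set q : ℝ := 1 + ((d : ℝ) - (m + 1)) / 2 with hq
  have hmd' : (m : ℝ) ≤ d := by exact_mod_cast hmd
  have hq0 : 0 < q := by rw [hq]; linarith
  set σ := μ.map paraboloidLift with hσ
  have hσprob : IsProbabilityMeasure σ := Measure.isProbabilityMeasure_map hlm.aemeasurable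
  set g : EuclideanSpace ℝ (Fin (d + 1)) → ℝ≥0∞ :=
    fun v => ENNReal.ofReal (Real.exp (‖v‖ ^ 2 / 2)) with hg
  have hgm : Measurable g := by fun_prop
  -- Undoing a Gaussian makes `σ` exactly `exp (-‖v‖² / 2)` times `ρ`; `ρ` is finite since `g` is
  -- bounded on the compact lift of `E`.
  set ρ := σ.withDensity g with hρ
  set c : ℝ≥0∞ := ENNReal.ofReal (Real.exp (R' ^ 2 / 2)) with hc
  have hgc : ∀ᵐ v ∂σ, g v ≤ c := by
    rw [hσ, ae_map_iff hlm.aemeasurable (measurableSet_le hgm measurable_const)]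
    filter_upwards [hEae] with x hx
    refine ENNReal.ofReal_le_ofReal (Real.exp_le_exp.2 ?_)
    gcongr
    exact hR' _ (mem_image_of_mem _ hx)
  have hρσ : ρ ≤ c • σ := by
    rw [← withDensity_const]
    exact withDensity_mono hgc
  have hρfin : IsFiniteMeasure ρ := by
    have : IsFiniteMeasure (c • σ) := Measure.smul_finite _ ENNReal.ofReal_ne_top
    exact isFiniteMeasure_of_le _ hρσ
  have henergy : ∀ b : ℝ, 0 < b → ∫⁻ y, ∫⁻ z, ENNReal.ofReal (Real.exp (-b * ‖y - z‖ ^ 2)) ∂ρ ∂ρ ≤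
      ENNReal.ofReal (Real.exp (R' ^ 2 / 2) * (Real.exp (R' ^ 2 / 2) *
        (C * Real.Gamma (s / 2 + 1))) * b ^ (-s / 2)) := by
    intro b hb
    calc _ ≤ ∫⁻ y, ∫⁻ z, ENNReal.ofReal (Real.exp (-b * ‖y - z‖ ^ 2)) ∂(c • σ) ∂(c • σ) :=
          lintegral_mono' hρσ fun y => lintegral_mono' hρσ le_rfl
      _ = c * (c * ∫⁻ y, ∫⁻ z, ENNReal.ofReal (Real.exp (-b * ‖y - z‖ ^ 2)) ∂σ ∂σ) := by
          simp_rw [lintegral_smul_measure, smul_eq_mul]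
          rw [lintegral_const_mul' _ _ ENNReal.ofReal_ne_top]
      _ ≤ c * (c * ∫⁻ _y, ENNReal.ofReal (C * Real.Gamma (s / 2 + 1) * b ^ (-s / 2)) ∂μ) := by
          gcongr
          have hm2 : Measurable fun p : EuclideanSpace ℝ (Fin (d + 1)) ×
              EuclideanSpace ℝ (Fin (d + 1)) =>
              ENNReal.ofReal (Real.exp (-b * ‖p.1 - p.2‖ ^ 2)) := by fun_prop
          rw [hσ, lintegral_map hm2.lintegral_prod_right' hlm]
          refine lintegral_mono fun y => ?_
          rw [lintegral_map (by fun_prop) hlm]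
          refine le_trans (lintegral_mono fun z => ?_) (lintegral_exp_neg_mul_sq_le μ
            (D := fun z => dist z y) (by fun_prop) hC hs (fun r hr => h y r hr) hb)
          refine ENNReal.ofReal_le_ofReal (Real.exp_le_exp.2 ?_)
          rw [neg_mul, neg_mul, neg_le_neg_iff, dist_comm, dist_eq_norm]
          exact mul_le_mul_of_nonneg_left (norm_sub_le_norm_paraboloidLift_sub y z) hb.le
      _ = _ := by
          rw [lintegral_const, measure_univ, mul_one, hc, ← ENNReal.ofReal_mul (by positivity),
            ← ENNReal.ofReal_mul (by positivity)]
          congr 1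
          ring
  have hfinite := lintegral_charFun_sq_mul_weight_lt_top ρ (q := q) (by positivity) hq0
    (by rw [finrank_euclideanSpace_fin]; push_cast; rw [hq]; linarith) henergy
  obtain ⟨K, hK, hKle⟩ := exists_lintegral_gaussian_pinCombination_le μ hC hs hq0.le
    (le_max_right R 0) h hRae (m := m) (by rw [hq]; linarith)
  have hchar : ∀ ξ, charFun σ ξ =
      ∫ y, (Real.exp (-‖y‖ ^ 2 / 2) : ℂ) * Complex.exp (⟪y, ξ⟫ * Complex.I) ∂ρ := by
    intro ξ
    rw [hρ, integral_withDensity_eq_integral_toReal_smul hgm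
      (Eventually.of_forall fun v => ENNReal.ofReal_lt_top), charFun_apply]
    refine integral_congr_ae (Eventually.of_forall fun v => ?_)
    simp only [hg]
    rw [ENNReal.toReal_ofReal (Real.exp_pos _).le, Complex.real_smul, ← mul_assoc,
      ← Complex.ofReal_mul, ← Real.exp_add, show ‖v‖ ^ 2 / 2 + -‖v‖ ^ 2 / 2 = 0 by ring]
    simp
  have hcm : Measurable (fun ζ => ENNReal.ofReal (‖charFun ρ ζ‖ ^ 2)) :=
    (measurable_charFun.norm.pow_const 2).ennreal_ofReal
  have hker : Measurable fun p : (EuclideanSpace ℝ (Fin (d + 1)) ×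
      ((Fin (m + 1) → ℝ) × (Fin (m + 1) → EuclideanSpace ℝ (Fin d)))) =>
      ENNReal.ofReal (Real.exp (-(1 / 2) * ‖p.1 - pinCombination p.2.1 p.2.2‖ ^ 2)) := by
    have h1 : Continuous fun p : (EuclideanSpace ℝ (Fin (d + 1)) ×
      ((Fin (m + 1) → ℝ) × (Fin (m + 1) → EuclideanSpace ℝ (Fin d)))) =>
        pinCombination p.2.1 p.2.2 := continuous_pinCombination.comp continuous_snd
    fun_prop
  refine ne_top_of_le_ne_top (ENNReal.mul_ne_top hfinite.ne hK) ?_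
  calc _ ≤ ∫⁻ x, (∫⁻ τ : Fin (m + 1) → ℝ, ∫⁻ ζ, ENNReal.ofReal (‖charFun ρ ζ‖ ^ 2) *
        ENNReal.ofReal (Real.exp (-(1 / 2) * ‖ζ - pinCombination τ x‖ ^ 2)))
          ∂(Measure.pi fun _ => μ) := by
        refine lintegral_mono fun x => lintegral_mono fun τ => ?_
        rw [hchar]
        exact norm_sq_integral_char_mul_gaussian_le ρ _
    _ = ∫⁻ τ : Fin (m + 1) → ℝ, ∫⁻ x, (∫⁻ ζ, ENNReal.ofReal (‖charFun ρ ζ‖ ^ 2) *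
        ENNReal.ofReal (Real.exp (-(1 / 2) * ‖ζ - pinCombination τ x‖ ^ 2)))
          ∂(Measure.pi fun _ => μ) := by
        refine lintegral_lintegral_swap (Measurable.aemeasurable ?_)
        refine Measurable.lintegral_prod_right' (f := fun p :
          ((Fin (m + 1) → EuclideanSpace ℝ (Fin d)) × (Fin (m + 1) → ℝ)) ×
            EuclideanSpace ℝ (Fin (d + 1)) => ENNReal.ofReal (‖charFun ρ p.2‖ ^ 2) *
        ENNReal.ofReal (Real.exp (-(1 / 2) * ‖p.2 - pinCombination p.1.2 p.1.1‖ ^ 2))) ?_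
        refine (hcm.comp measurable_snd).mul ?_
        exact hker.comp (f := fun p : ((Fin (m + 1) → EuclideanSpace ℝ (Fin d)) ×
          (Fin (m + 1) → ℝ)) × EuclideanSpace ℝ (Fin (d + 1)) => (p.2, (p.1.2, p.1.1)))
          (by fun_prop)
    _ = ∫⁻ τ : Fin (m + 1) → ℝ, ∫⁻ ζ, ENNReal.ofReal (‖charFun ρ ζ‖ ^ 2) * ∫⁻ x,
        ENNReal.ofReal (Real.exp (-(1 / 2) * ‖ζ - pinCombination τ x‖ ^ 2))
          ∂(Measure.pi fun _ => μ) := by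
        refine lintegral_congr fun τ => ?_
        rw [lintegral_lintegral_swap]
        · refine lintegral_congr fun ζ => ?_
          rw [lintegral_const_mul' _ _ ENNReal.ofReal_ne_top]
        · refine Measurable.aemeasurable ((hcm.comp measurable_snd).mul ?_)
          exact hker.comp (f := fun p : (Fin (m + 1) → EuclideanSpace ℝ (Fin d)) ×
            EuclideanSpace ℝ (Fin (d + 1)) => (p.2, (τ, p.1))) (by fun_prop)
    _ = ∫⁻ ζ, ENNReal.ofReal (‖charFun ρ ζ‖ ^ 2) * ∫⁻ τ : Fin (m + 1) → ℝ, ∫⁻ x,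
        ENNReal.ofReal (Real.exp (-(1 / 2) * ‖ζ - pinCombination τ x‖ ^ 2))
          ∂(Measure.pi fun _ => μ) := by
        rw [lintegral_lintegral_swap]
        · refine lintegral_congr fun ζ => ?_
          rw [lintegral_const_mul' _ _ ENNReal.ofReal_ne_top]
        · refine Measurable.aemeasurable ((hcm.comp measurable_snd).mul ?_)
          refine Measurable.lintegral_prod_right' (f := fun p :
            ((Fin (m + 1) → ℝ) × EuclideanSpace ℝ (Fin (d + 1))) ×
            (Fin (m + 1) → EuclideanSpace ℝ (Fin d)) =>
            ENNReal.ofReal (Real.exp (-(1 / 2) * ‖p.1.2 - pinCombination p.1.1 p.2‖ ^ 2))) ?_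
          exact hker.comp (f := fun p : ((Fin (m + 1) → ℝ) × EuclideanSpace ℝ (Fin (d + 1))) ×
            (Fin (m + 1) → EuclideanSpace ℝ (Fin d)) => (p.1.2, (p.1.1, p.2))) (by fun_prop)
    _ ≤ ∫⁻ ζ, ENNReal.ofReal (‖charFun ρ ζ‖ ^ 2) *
        (K * ENNReal.ofReal ((1 + ‖ζ‖ ^ 2) ^ (-q / 2))) := by
        refine lintegral_mono fun ζ => mul_le_mul_right ?_ _
        simp_rw [norm_sub_rev ζ]
        exact hKle ζ
    _ = _ := by
        rw [← lintegral_mul_const' _ _ hK]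
        refine lintegral_congr fun ζ => ?_
        ring

/-- For almost every choice of `m + 1` pins, the distances to the pins push the Frostman measure
forward to an absolutely continuous measure. -/
theorem ae_absolutelyContinuous_map_norm_sub (μ : Measure (EuclideanSpace ℝ (Fin d)))
    [IsProbabilityMeasure μ] {C s : ℝ} (hC : 0 ≤ C)
    (h : ∀ x r, 0 < r → μ (closedBall x r) ≤ ENNReal.ofReal (C * r ^ s))
    {E : Set (EuclideanSpace ℝ (Fin d))} (hE : IsCompact E) (hμE : μ Eᶜ = 0)
    {m : ℕ} (hmd : m ≤ d) (hm : ((d : ℝ) + (m + 1)) / 2 < s) :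
    ∀ᵐ x ∂(Measure.pi fun _ : Fin (m + 1) => μ),
      μ.map (fun y i => ‖x i - y‖) ≪ (volume : Measure (Fin (m + 1) → ℝ)) := by
  have hfin := lintegral_charFun_map_paraboloidLift_ne_top μ hC h hE hμE hmd hm
  have hlm : Measurable (paraboloidLift (d := d)) := continuous_paraboloidLift.measurable
  have hmeas : Measurable fun x => ∫⁻ τ : Fin (m + 1) → ℝ,
      ENNReal.ofReal (‖charFun (μ.map paraboloidLift) (pinCombination τ x)‖ ^ 2) := by
    have : IsProbabilityMeasure (μ.map (paraboloidLift (d := d))) :=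
      Measure.isProbabilityMeasure_map hlm.aemeasurable
    refine Measurable.lintegral_prod_right' (f := fun p :
      (Fin (m + 1) → EuclideanSpace ℝ (Fin d)) × (Fin (m + 1) → ℝ) =>
      ENNReal.ofReal (‖charFun (μ.map paraboloidLift) (pinCombination p.2 p.1)‖ ^ 2)) ?_
    refine Measurable.ennreal_ofReal (Measurable.pow_const (Measurable.norm ?_) 2)
    exact measurable_charFun.comp (continuous_pinCombination.comp continuous_swap).measurable
  filter_upwards [ae_lt_top hmeas hfin] with x hx
  set Φ : EuclideanSpace ℝ (Fin d) → EuclideanSpace ℝ (Fin (m + 1)) :=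
    fun y => WithLp.toLp 2 (fun i => ‖x i - y‖ ^ 2 - ‖x i‖ ^ 2) with hΦ
  have hΦc : Continuous Φ := (PiLp.continuous_toLp 2 _).comp (by fun_prop)
  -- The shifted squared distances are a linear image of the lifted measure, so their transform is
  -- that of the lift restricted to the span of the pin vectors.
  have hchar : ∀ τ : EuclideanSpace ℝ (Fin (m + 1)),
      charFun (μ.map Φ) τ = charFun (μ.map paraboloidLift) (pinCombination τ.ofLp x) := by
    intro τ
    rw [charFun_apply, charFun_apply, integral_map hΦc.aemeasurable (by fun_prop),
      integral_map hlm.aemeasurable (by fun_prop)]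
    refine integral_congr_ae (Eventually.of_forall fun y => ?_)
    have : ⟪Φ y, τ⟫ = ⟪paraboloidLift y, pinCombination τ.ofLp x⟫ := by
      rw [pinCombination, inner_sum, PiLp.inner_apply]
      refine Finset.sum_congr rfl fun i _ => ?_
      rw [inner_smul_right, real_inner_comm (pinVector (x i)), inner_pinVector_paraboloidLift]
      simp [hΦ]
    simp only [this]
  have hac : μ.map Φ ≪ volume := by
    have : IsProbabilityMeasure (μ.map Φ) := Measure.isProbabilityMeasure_map hΦc.aemeasurable
    refine absolutelyContinuous_of_lintegral_charFun_sq _ ?_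
    simp_rw [hchar]
    have := (PiLp.volume_preserving_ofLp (Fin (m + 1))).lintegral_comp_emb
      (MeasurableEquiv.toLp 2 (Fin (m + 1) → ℝ)).symm.measurableEmbedding
      (fun τ => ENNReal.ofReal (‖charFun (μ.map paraboloidLift) (pinCombination τ x)‖ ^ 2))
    rw [this]
    exact hx.ne
  have hac' : μ.map (fun y => (Φ y).ofLp) ≪ (volume : Measure (Fin (m + 1) → ℝ)) := by
    have h1 := hac.map (f := @WithLp.ofLp 2 (Fin (m + 1) → ℝ)) (by fun_prop)
    rw [(PiLp.volume_preserving_ofLp (Fin (m + 1))).map_eq,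
      Measure.map_map (by fun_prop) hΦc.measurable] at h1
    exact h1
  refine Measure.AbsolutelyContinuous.mk fun N hN hN0 => ?_
  rw [Measure.map_apply (by fun_prop) hN]
  -- Return from squared distances to distances: a differentiable map sends null sets to null sets,
  -- so no inverse is needed.
  have himg : (volume : Measure (Fin (m + 1) → ℝ)) ((fun t i => t i ^ 2 - ‖x i‖ ^ 2) '' N) = 0 :=
    addHaar_image_eq_zero_of_differentiableOn_of_addHaar_eq_zero _ (by fun_prop) hN0
  refine measure_mono_null ?_ (Measure.preimage_null_of_map_null
    (by exact Continuous.aemeasurable (by fun_prop)) (hac' himg))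
  intro y hy
  exact ⟨_, hy, rfl⟩

end PinnedProjection

/-! ### Building simplices vertex by vertex -/

section Simplices

open Filter Topology Set Metric PinnedSimplex

/-- The vertex pairs of a `(j+1)`-simplex are those of its face opposite to the last vertex,
together with the pairs containing the last vertex. -/
def vertexPairOfSum (j : ℕ) : VertexPair j ⊕ Fin (j + 1) → VertexPair (j + 1)
  | Sum.inl p => ⟨(p.1.1.castSucc, p.1.2.castSucc), p.2⟩
  | Sum.inr i => ⟨(i.castSucc, Fin.last (j + 1)), Fin.castSucc_lt_last i⟩

theorem vertexPairOfSum_bijective (j : ℕ) : Function.Bijective (vertexPairOfSum j) := by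
  constructor
  · rintro (⟨⟨a, b⟩, h⟩ | i) (⟨⟨a', b'⟩, h'⟩ | i') hh
    · simp [vertexPairOfSum] at hh
      simp [hh]
    · have := (Fin.castSucc_lt_last b).ne
      simp [vertexPairOfSum, this] at hh
    · have := (Fin.castSucc_lt_last b').ne'
      simp [vertexPairOfSum, this] at hh
    · simp [vertexPairOfSum] at hh
      simp [hh]
  · rintro ⟨⟨a, b⟩, h⟩
    have ha : a ≠ Fin.last (j + 1) := (h.trans_le (Fin.le_last b)).ne
    by_cases hb : b = Fin.last (j + 1)
    · subst hb
      exact ⟨Sum.inr (a.castPred ha), by simp [vertexPairOfSum]⟩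
    · exact ⟨Sum.inl ⟨(a.castPred ha, b.castPred hb), by simpa using h⟩, by simp [vertexPairOfSum]⟩

/-- The list of side lengths of a tuple of points. -/
noncomputable def tupleSideLengths {d k : ℕ} (v : Fin (k + 1) → EuclideanSpace ℝ (Fin d)) :
    VertexPair k → ℝ :=
  fun p => ‖v p.1.1 - v p.1.2‖

/-- Gluing the side lengths of a face and the distances to the last vertex. -/
noncomputable def glueSideLengths (j : ℕ) (a : (VertexPair j → ℝ) × (Fin (j + 1) → ℝ)) : VertexPair (j + 1) → ℝ :=
  MeasurableEquiv.piCongrLeft (fun _ => ℝ) (Equiv.ofBijective _ (vertexPairOfSum_bijective j))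
    ((MeasurableEquiv.sumPiEquivProdPi fun _ => ℝ).symm a)

theorem measurePreserving_glueSideLengths (j : ℕ) : MeasurePreserving (glueSideLengths j) :=
  (volume_measurePreserving_piCongrLeft (fun _ => ℝ)
    (Equiv.ofBijective _ (vertexPairOfSum_bijective j))).comp
    (volume_measurePreserving_sumPiEquivProdPi_symm fun _ => ℝ)

theorem tupleSideLengths_snoc {d j : ℕ} (v : Fin (j + 1) → EuclideanSpace ℝ (Fin d))
    (y : EuclideanSpace ℝ (Fin d)) :
    tupleSideLengths (Fin.snoc v y : Fin (j + 2) → EuclideanSpace ℝ (Fin d)) =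
      glueSideLengths j (tupleSideLengths v, fun i => ‖v i - y‖) := by
  funext p
  obtain ⟨q, rfl⟩ := (Equiv.ofBijective _ (vertexPairOfSum_bijective j)).surjective p
  rw [glueSideLengths, MeasurableEquiv.piCongrLeft_apply_apply]
  rcases q with p | i
  · simp [tupleSideLengths, vertexPairOfSum, MeasurableEquiv.coe_sumPiEquivProdPi_symm]
  · simp [tupleSideLengths, vertexPairOfSum, MeasurableEquiv.coe_sumPiEquivProdPi_symm]

theorem ae_ae_cons_of_ae_pi {X : Type*} [MeasurableSpace X] (μ : Measure X) [SigmaFinite μ] {j : ℕ}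
    {P : (Fin (j + 1) → X) → Prop} (h : ∀ᵐ v ∂(Measure.pi fun _ : Fin (j + 1) => μ), P v) :
    ∀ᵐ x ∂μ, ∀ᵐ w ∂(Measure.pi fun _ : Fin j => μ), P (Fin.cons x w) := by
  have hmp := (measurePreserving_piFinSuccAbove (fun _ : Fin (j + 1) => μ) 0).symm
  have h1 := Measure.ae_ae_of_ae_prod (hmp.quasiMeasurePreserving.ae h)
  filter_upwards [h1] with x hx
  filter_upwards [hx] with w hw
  rw [← Fin.insertNth_zero']
  exact hw

theorem continuous_tupleSideLengths_cons {d j : ℕ} (x : EuclideanSpace ℝ (Fin d)) :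
    Continuous fun w : Fin j → EuclideanSpace ℝ (Fin d) =>
      tupleSideLengths (Fin.cons x w : Fin (j + 1) → EuclideanSpace ℝ (Fin d)) := by
  have h : ∀ i, Continuous fun w : Fin j → EuclideanSpace ℝ (Fin d) =>
      (Fin.cons x w : Fin (j + 1) → EuclideanSpace ℝ (Fin d)) i := by
    intro i
    refine Fin.cases ?_ (fun i => ?_) i
    · simpa using continuous_const
    · simpa using continuous_apply i
  exact continuous_pi fun p => ((h _).sub (h _)).norm

/-- If, for `j = 1, …, k`, the distances to almost every `j`-tuple of pins push `μ` forward to an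
absolutely continuous measure, then so do the side lengths of `k`-simplices with almost every
given first vertex. -/
theorem ae_absolutelyContinuous_map_tupleSideLengths {d : ℕ}
    (μ : Measure (EuclideanSpace ℝ (Fin d))) [IsProbabilityMeasure μ] (k : ℕ)
    (h : ∀ m < k, ∀ᵐ x ∂(Measure.pi fun _ : Fin (m + 1) => μ),
      μ.map (fun y i => ‖x i - y‖) ≪ (volume : Measure (Fin (m + 1) → ℝ))) :
    ∀ᵐ x ∂μ, (Measure.pi fun _ : Fin k => μ).map (fun w => tupleSideLengths
      (Fin.cons x w : Fin (k + 1) → EuclideanSpace ℝ (Fin d))) ≪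
        (volume : Measure (VertexPair k → ℝ)) := by
  induction k with
  | zero =>
    refine Eventually.of_forall fun x N hN => ?_
    have hempty : IsEmpty (VertexPair 0) := ⟨fun p => by
      have := p.2
      omega⟩
    -- With no pairs the target is a single point of volume `1`, so only the empty set is null.
    rcases N.eq_empty_or_nonempty with h0 | ⟨a, ha⟩
    · simp [h0]
    · have hN1 : N = univ := eq_univ_of_forall fun b => by rwa [Subsingleton.elim b a]
      rw [hN1, volume_pi, Measure.pi_univ] at hN
      simp at hN
  | succ j ih =>
    filter_upwards [ih fun m hm => h m (hm.trans j.lt_succ_self),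
      ae_ae_cons_of_ae_pi μ (h j j.lt_succ_self)] with x hx1 hx2
    refine Measure.AbsolutelyContinuous.mk fun N hN hN0 => ?_
    have hc := (continuous_tupleSideLengths_cons (j := j + 1) x).measurable
    have hcj := (continuous_tupleSideLengths_cons (j := j) x).measurable
    have hind : Measurable (indicator ((fun w => tupleSideLengths (Fin.cons x w :
        Fin (j + 2) → EuclideanSpace ℝ (Fin d))) ⁻¹' N) (1 : (Fin (j + 1) → EuclideanSpace ℝ (Fin d)) → ℝ≥0∞)) :=
      measurable_one.indicator (hc hN)
    have hins : Measurable fun p : EuclideanSpace ℝ (Fin d) × (Fin j → EuclideanSpace ℝ (Fin d)) =>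
        (Fin.last j).insertNth (α := fun _ => EuclideanSpace ℝ (Fin d)) p.1 p.2 :=
      (MeasurableEquiv.piFinSuccAbove (fun _ => EuclideanSpace ℝ (Fin d)) (Fin.last j)).symm.measurable
    rw [Measure.map_apply hc hN, ← lintegral_indicator_one (hc hN),
      lintegral_pi_eq_lintegral_insertNth μ (Fin.last j)
        hind,
      lintegral_eq_zero_iff (by exact (hind.comp hins).lintegral_prod_left')]
    have hG := measurePreserving_glueSideLengths j
    have h1 : ∀ᵐ a ∂(volume : Measure ((VertexPair j → ℝ) × (Fin (j + 1) → ℝ))),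
        glueSideLengths j a ∉ N :=
      hG.quasiMeasurePreserving.ae (measure_eq_zero_iff_ae_notMem.1 hN0)
    rw [Measure.volume_eq_prod] at h1
    -- For a.e. face through `x`, the induction hypothesis leaves only a null set of bad vectors of
    -- distances to a new vertex; absolute continuity for these pins, in `h3`, then excludes a.e.
    -- new vertex.
    have h2 := ae_of_ae_map hcj.aemeasurable (hx1.ae_le (Measure.ae_ae_of_ae_prod h1))
    filter_upwards [h2, hx2] with w hw1 hw2
    have h3 := ae_of_ae_map (by exact Continuous.aemeasurable (by fun_prop)) (hw2.ae_le hw1)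
    rw [Pi.zero_apply, lintegral_eq_zero_iff' ?_]
    · filter_upwards [h3] with y hy
      rw [Fin.insertNth_last', Pi.zero_apply]
      refine indicator_of_notMem (fun hmem => hy ?_) _
      rw [mem_preimage, Fin.cons_snoc_eq_snoc_cons, tupleSideLengths_snoc] at hmem
      exact hmem
    · exact ((hind.comp hins).comp measurable_prodMk_right).aemeasurable

end Simplices

/-! ### Conclusion -/

theorem mainTheorem1 (d k : ℕ) (hk : 1 ≤ k) (hkd : k ≤ d)
    (E : Set (EuclideanSpace ℝ (Fin d))) (hE : IsCompact E)
    (hdim : ((d : ℝ≥0∞) + (k : ℝ≥0∞)) / 2 < dimH E) :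
    ∃ x ∈ E,
      0 < (volume : Measure (PinnedSimplex.VertexPair k → ℝ))
        (PinnedSimplex.sideLengths '' PinnedSimplex.pinnedSimplices k E x) := by
  obtain ⟨s, hs1, hs2⟩ := ENNReal.lt_iff_exists_nnreal_btwn.1 hdim
  have hs : ((d : ℝ) + k) / 2 < s := by
    have h1 : (((d : NNReal) + k) / 2 : NNReal) < s := by
      rw [← ENNReal.coe_lt_coe]
      push_cast
      exact hs1
    exact_mod_cast h1
  have hk' : (1 : ℝ) ≤ k := by exact_mod_cast hk
  have hs0 : (0 : ℝ) < s := lt_of_le_of_lt (by positivity) hs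
  obtain ⟨μ, hμ, hμE, C, hC, hfr⟩ := exists_frostman_measure hE hs0
    (by rw [hausdorffMeasure_of_lt_dimH hs2]; exact ENNReal.top_ne_zero)
  have hEae : ∀ᵐ x ∂μ, x ∈ E := hμE
  have hac := ae_absolutelyContinuous_map_tupleSideLengths μ k fun m hm =>
    ae_absolutelyContinuous_map_norm_sub μ hC hfr hE hμE (by omega) (by
      have : (m : ℝ) + 1 ≤ k := by exact_mod_cast hm
      linarith)
  obtain ⟨x, hxE, hx⟩ := (hEae.and hac).exists
  refine ⟨x, hxE, pos_iff_ne_zero.2 fun h0 => ?_⟩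
  -- If the pinned set were null, almost every `w` would have side lengths outside it, although
  -- almost every `w` has all its vertices in `E`.
  have h1 := Measure.preimage_null_of_map_null
    (continuous_tupleSideLengths_cons x).aemeasurable (hx h0)
  have h2 : ∀ᵐ w ∂(Measure.pi fun _ : Fin k => μ), ∀ i, w i ∈ E :=
    ae_all_iff.2 fun i => (Measure.quasiMeasurePreserving_eval (fun _ => μ) i).ae hEae
  obtain ⟨w, hw1, hw2⟩ := ((measure_eq_zero_iff_ae_notMem.1 h1).and h2).exists
  refine hw1 ⟨_, ⟨Fin.cons x w, fun i => ?_, by simp, rfl⟩, rfl⟩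
  refine Fin.cases ?_ (fun i => ?_) i
  · simpa using hxE
  · simpa using hw2 i
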